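/- Let $G_{5,3}$ be the Lie group which is $\mathbb R^5$ as a set (with the usual topology), with multiplication $$(h,j,k,m,n)(h',j',k',m',n')=\bigl(h+h'+nj'+m'\tfrac{n(n-1)}2+mk',\; j+j'+nm',\; k+k',\; m+m',\; n+n'\bigr),$$ and let $H_{5,3}=\mathbb Z^5\subset G_{5,3}$ be its lattice subgroup of elements with integer coordinates. For integers $\alpha,\beta,\gamma,\delta,\epsilon$ let $H_{5,3}(\alpha,\beta,\gamma,\delta,\epsilon)$ be the group which is $\mathbb Z^5$ as a set, with multiplication $$(h,j,k,m,n)(h',j',k',m',n')=\bigl(h+h'+\gamma nj'+\alpha\gamma m'\tfrac{n(n-1)}2+\beta nm'+\delta mk'+\epsilon nk',\; j+j'+\alpha nm',\; k+k',\; m+m',\; n+n'\bigr).$$ Call $(\alpha,\beta,\gamma,\delta,\epsilon)\in\mathbb Z^5$ admissible if $\alpha,\gamma,\delta>0$, $$0\le\epsilon\le \gcd\{\gamma,\delta\}/2\quad\text{and}\quad 0\le\beta\le\gcd\{\alpha,\gamma,\delta,\epsilon\}/2 .$$ **Theorem 1.** (1) Every discrete cocompact subgroup of $G_{5,3}$ is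 isomorphic to $H_{5,3}(\alpha,\beta,\gamma,\delta,\epsilon)$ for some admissible $(\alpha,\beta,\gamma,\delta,\epsilon)$. (2) Different admissible choices of $(\alpha,\beta,\gamma,\delta,\epsilon)$ give non-isomorphic groups. (3) For every admissible $(\alpha,\beta,\gamma,\delta,\epsilon)$, the group $H_{5,3}(\alpha,\beta,\gamma,\delta,\epsilon)$ is isomorphic to a subgroup of finite index of $H_{5,3}$. (4) Every subgroup of finite index of $H_{5,3}$ is isomorphic to $H_{5,3}(\alpha,\beta,\gamma,\delta,\epsilon)$ for some admissible $(\alpha,\beta,\gamma,\delta,\epsilon)$. -/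

import Mathlib

/-- The underlying set `ℝ⁵` of the Lie group `G_{5,3}`; an element is `(h, j, k, m, n)`. -/
@[ext]
structure G53 where
  h : ℝ
  j : ℝ
  k : ℝ
  m : ℝ
  n : ℝ

namespace G53

noncomputable instance : Mul G53 :=
  ⟨fun x y =>
    ⟨x.h + y.h + x.n * y.j + y.m * (x.n * (x.n - 1) / 2) + x.m * y.k,
      x.j + y.j + x.n * y.m, x.k + y.k, x.m + y.m, x.n + y.n⟩⟩

instance : One G53 := ⟨⟨0, 0, 0, 0, 0⟩⟩

noncomputable instance : Inv G53 :=
  ⟨fun x =>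
    ⟨-x.h + x.n * x.j + x.m * x.k - x.m * (x.n * (x.n + 1) / 2),
      -x.j + x.n * x.m, -x.k, -x.m, -x.n⟩⟩

theorem mul_def (x y : G53) :
    x * y = ⟨x.h + y.h + x.n * y.j + y.m * (x.n * (x.n - 1) / 2) + x.m * y.k,
      x.j + y.j + x.n * y.m, x.k + y.k, x.m + y.m, x.n + y.n⟩ := rfl

theorem one_def : (1 : G53) = ⟨0, 0, 0, 0, 0⟩ := rfl

theorem inv_def (x : G53) :
    x⁻¹ = ⟨-x.h + x.n * x.j + x.m * x.k - x.m * (x.n * (x.n + 1) / 2),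
      -x.j + x.n * x.m, -x.k, -x.m, -x.n⟩ := rfl

noncomputable instance : Group G53 :=
  Group.ofLeftAxioms
    (fun x y z => by ext <;> simp only [mul_def] <;> ring)
    (fun x => by ext <;> simp only [mul_def, one_def] <;> ring)
    (fun x => by ext <;> simp only [mul_def, one_def, inv_def] <;> ring)

/-- Coordinates, as a map to `ℝ⁵ = ℝ × ℝ × ℝ × ℝ × ℝ`. -/
def coords (x : G53) : ℝ × ℝ × ℝ × ℝ × ℝ := (x.h, x.j, x.k, x.m, x.n)

/-- `G_{5,3}` carries the usual topology of `ℝ⁵`. -/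
instance : TopologicalSpace G53 := TopologicalSpace.induced coords inferInstance

theorem continuous_coords : Continuous coords := continuous_induced_dom

theorem continuous_h : Continuous G53.h := continuous_fst.comp continuous_coords

theorem continuous_j : Continuous G53.j :=
  (continuous_fst.comp continuous_snd).comp continuous_coords

theorem continuous_k : Continuous G53.k :=
  (continuous_fst.comp (continuous_snd.comp continuous_snd)).comp continuous_coords

theorem continuous_m : Continuous G53.m :=
  (continuous_fst.comp (continuous_snd.comp (continuous_snd.comp continuous_snd))).comp
    continuous_coords

theorem continuous_n : Continuous G53.n :=
  (continuous_snd.comp (continuous_snd.comp (continuous_snd.comp continuous_snd))).comp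
    continuous_coords

/-- The multiplication and the inversion of `G_{5,3}` are continuous. -/
instance : IsTopologicalGroup G53 where
  continuous_mul := by
    have h1 := continuous_h
    have h2 := continuous_j
    have h3 := continuous_k
    have h4 := continuous_m
    have h5 := continuous_n
    refine continuous_induced_rng.2 ?_
    simp only [Function.comp_def, coords, mul_def]
    fun_prop
  continuous_inv := by
    have h1 := continuous_h
    have h2 := continuous_j
    have h3 := continuous_k
    have h4 := continuous_m
    have h5 := continuous_n
    refine continuous_induced_rng.2 ?_
    simp only [Function.comp_def, coords, inv_def]
    fun_prop

end G53

theorem int_two_mul_pred_half (n : ℤ) : 2 * (n * (n - 1) / 2) = n * (n - 1) :=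
  Int.mul_ediv_cancel' (even_iff_two_dvd.1 (Int.even_mul_pred_self n))

/-- The lattice subgroup `H_{5,3} = ℤ⁵` of `G_{5,3}`: the elements with integer coordinates. -/
def H53Lattice : Subgroup G53 where
  carrier := {x | ∃ h j k m n : ℤ, x = ⟨h, j, k, m, n⟩}
  one_mem' := ⟨0, 0, 0, 0, 0, by simp [G53.one_def]⟩
  mul_mem' := by
    rintro _ _ ⟨h, j, k, m, n, rfl⟩ ⟨h', j', k', m', n', rfl⟩
    refine ⟨h + h' + n * j' + m' * (n * (n - 1) / 2) + m * k', j + j' + n * m', k + k',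
      m + m', n + n', ?_⟩
    have e : (2 : ℝ) * ((n * (n - 1) / 2 : ℤ) : ℝ) = (n : ℝ) * (n - 1) := by
      exact_mod_cast int_two_mul_pred_half n
    ext <;> simp only [G53.mul_def] <;> push_cast
    · linear_combination (-(m' : ℝ) / 2) * e
    all_goals rfl
  inv_mem' := by
    rintro _ ⟨h, j, k, m, n, rfl⟩
    refine ⟨-h + n * j + m * k - m * (n * (n - 1) / 2 + n), -j + n * m, -k, -m, -n, ?_⟩
    have e : (2 : ℝ) * ((n * (n - 1) / 2 : ℤ) : ℝ) = (n : ℝ) * (n - 1) := by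
      exact_mod_cast int_two_mul_pred_half n
    ext <;> simp only [G53.inv_def] <;> push_cast
    · linear_combination ((m : ℝ) / 2) * e
    all_goals rfl

/-- The underlying set `ℤ⁵` of the group `H_{5,3}(α, β, γ, δ, ε)`. -/
@[ext]
structure H53 (α β γ δ ε : ℤ) where
  h : ℤ
  j : ℤ
  k : ℤ
  m : ℤ
  n : ℤ

namespace H53

variable {α β γ δ ε : ℤ}

/-- The multiplication of `H_{5,3}(α, β, γ, δ, ε)`; the division by `2` is exact because
`n (n - 1)` is even. -/
instance : Mul (H53 α β γ δ ε) :=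
  ⟨fun x y =>
    ⟨x.h + y.h + γ * x.n * y.j + α * γ * y.m * (x.n * (x.n - 1) / 2) + β * x.n * y.m
        + δ * x.m * y.k + ε * x.n * y.k,
      x.j + y.j + α * x.n * y.m, x.k + y.k, x.m + y.m, x.n + y.n⟩⟩

instance : One (H53 α β γ δ ε) := ⟨⟨0, 0, 0, 0, 0⟩⟩

instance : Inv (H53 α β γ δ ε) :=
  ⟨fun x =>
    ⟨-x.h + γ * x.n * x.j - α * γ * x.m * (x.n * (x.n - 1) / 2 + x.n) + β * x.n * x.m
        + δ * x.m * x.k + ε * x.n * x.k,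
      -x.j + α * x.n * x.m, -x.k, -x.m, -x.n⟩⟩

theorem mul_def (x y : H53 α β γ δ ε) :
    x * y = ⟨x.h + y.h + γ * x.n * y.j + α * γ * y.m * (x.n * (x.n - 1) / 2) + β * x.n * y.m
        + δ * x.m * y.k + ε * x.n * y.k,
      x.j + y.j + α * x.n * y.m, x.k + y.k, x.m + y.m, x.n + y.n⟩ := rfl

theorem one_def : (1 : H53 α β γ δ ε) = ⟨0, 0, 0, 0, 0⟩ := rfl

theorem inv_def (x : H53 α β γ δ ε) :
    x⁻¹ = ⟨-x.h + γ * x.n * x.j - α * γ * x.m * (x.n * (x.n - 1) / 2 + x.n) + β * x.n * x.m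
        + δ * x.m * x.k + ε * x.n * x.k,
      -x.j + α * x.n * x.m, -x.k, -x.m, -x.n⟩ := rfl

theorem half_add (a b : ℤ) :
    (a + b) * (a + b - 1) / 2 = a * (a - 1) / 2 + b * (b - 1) / 2 + a * b := by
  have h1 := int_two_mul_pred_half (a + b)
  have h2 := int_two_mul_pred_half a
  have h3 := int_two_mul_pred_half b
  have : 2 * ((a + b) * (a + b - 1) / 2) =
      2 * (a * (a - 1) / 2 + b * (b - 1) / 2 + a * b) := by
    linear_combination h1 - h2 - h3
  omega

theorem half_neg (a : ℤ) : -a * (-a - 1) / 2 = a * (a - 1) / 2 + a := by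
  have h1 := int_two_mul_pred_half (-a)
  have h2 := int_two_mul_pred_half a
  have : 2 * (-a * (-a - 1) / 2) = 2 * (a * (a - 1) / 2 + a) := by
    linear_combination h1 - h2
  omega

instance : Group (H53 α β γ δ ε) :=
  Group.ofLeftAxioms
    (fun x y z => by ext <;> simp only [mul_def, half_add] <;> ring)
    (fun x => by ext <;> simp [mul_def, one_def])
    (fun x => by ext <;> simp only [mul_def, one_def, inv_def, half_neg] <;> ring)

end H53

/-- The conditions on the parameters: `α, γ, δ > 0`, `0 ≤ ε ≤ gcd{γ, δ}/2` and
`0 ≤ β ≤ gcd{α, γ, δ, ε}/2`. -/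
structure H53.Admissible (α β γ δ ε : ℤ) : Prop where
  α_pos : 0 < α
  γ_pos : 0 < γ
  δ_pos : 0 < δ
  ε_nonneg : 0 ≤ ε
  ε_le : (ε : ℝ) ≤ (Int.gcd γ δ : ℝ) / 2
  β_nonneg : 0 ≤ β
  β_le : (β : ℝ) ≤ (Int.gcd α (Int.gcd γ (Int.gcd δ ε)) : ℝ) / 2

/-! The parameters are the exponents in the relations [n,j] = h^γ, [m,k] = h^δ, [n,k] = h^ε and
[n,m] = h^β j^α, with h central and j commuting with k and m. Five elements of a group satisfying
them define a homomorphism, `H53.lift`. For γ, δ ≠ 0 it is injective as soon as it is so on the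
powers of h (`H53.injective_of_center`), because commutators push any kernel element into the
center.

Parts (1) and (4) share one structure theorem, `G53.exists_mulEquiv_H53`. Filter the subgroup by its
leading coordinate, in the order n, m, k, j, h. Commutators pair these layers into one another, so
discreteness of the central layer makes every layer cyclic, and lifts of the layer generators
satisfy the relations for some integers. Nontrivial layers come from cocompactness by pigeonhole, or
from finite index by taking powers.

Triangular changes of generators with diagonal ±1 adjust signs, shift ε by multiples of γ and δ, and
shift β by multiples of α, γ, δ, ε; this reaches an admissible tuple. Conversely every isomorphism
is such a change, so α, γ, δ are invariants, and so are ε and β up to sign modulo the two gcds: this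
is (2). Part (3) follows from explicit elements of H(1,0,1,1,0). -/

theorem zpow_mul_zpow_of_mul_eq {G : Type*} [Group G] {x y z : G} (hx : Commute z x)
    (hy : Commute z y) (h : x * y = z * y * x) (a b : ℤ) :
    x ^ a * y ^ b = z ^ (a * b) * y ^ b * x ^ a := by
  have h1 : SemiconjBy x (y ^ b) (z ^ b * y ^ b) := by
    have : SemiconjBy x y (z * y) := h
    simpa [hy.mul_zpow] using this.zpow_right b
  have h2 : SemiconjBy (y ^ b) (z ^ b * x) x := by
    show y ^ b * (z ^ b * x) = x * y ^ b
    rw [h1.eq, ← mul_assoc, (hy.zpow_zpow b b).eq]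
  have h3 := (h2.zpow_right a).eq
  rw [(hx.zpow_left b).mul_zpow, ← zpow_mul] at h3
  rw [← h3, mul_comm a b, ← mul_assoc, (hy.zpow_zpow _ _).eq]

/-! ### Relations and homomorphisms out of the groups H(α, β, γ, δ, ε) -/

namespace H53

/-- The defining relations of `H_{5,3}(α, β, γ, δ, ε)`, for five elements of a group. -/
structure Relations (α β γ δ ε : ℤ) {G : Type*} [Group G] (h j k m n : G) : Prop where
  comm_hj : Commute h j
  comm_hk : Commute h k
  comm_hm : Commute h m
  comm_hn : Commute h n
  comm_jk : Commute j k
  comm_jm : Commute j m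
  mul_nj : n * j = h ^ γ * j * n
  mul_mk : m * k = h ^ δ * k * m
  mul_nk : n * k = h ^ ε * k * n
  mul_nm : n * m = h ^ β * j ^ α * m * n

namespace Relations

variable {α β γ δ ε : ℤ} {G : Type*} [Group G] {h j k m n : G}

theorem zpow_n_mul_zpow_j (R : Relations α β γ δ ε h j k m n) (e b : ℤ) :
    n ^ e * j ^ b = h ^ (γ * e * b) * j ^ b * n ^ e := by
  rw [zpow_mul_zpow_of_mul_eq (R.comm_hn.zpow_left γ) (R.comm_hj.zpow_left γ) R.mul_nj,
    ← zpow_mul, mul_assoc γ]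

theorem zpow_n_mul_zpow_k (R : Relations α β γ δ ε h j k m n) (e c : ℤ) :
    n ^ e * k ^ c = h ^ (ε * e * c) * k ^ c * n ^ e := by
  rw [zpow_mul_zpow_of_mul_eq (R.comm_hn.zpow_left ε) (R.comm_hk.zpow_left ε) R.mul_nk,
    ← zpow_mul, mul_assoc ε]

theorem zpow_m_mul_zpow_k (R : Relations α β γ δ ε h j k m n) (d c : ℤ) :
    m ^ d * k ^ c = h ^ (δ * d * c) * k ^ c * m ^ d := by
  rw [zpow_mul_zpow_of_mul_eq (R.comm_hm.zpow_left δ) (R.comm_hk.zpow_left δ) R.mul_mk,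
    ← zpow_mul, mul_assoc δ]

theorem n_mul_zpow_m (R : Relations α β γ δ ε h j k m n) (d : ℤ) :
    n * m ^ d = h ^ (β * d) * j ^ (α * d) * m ^ d * n := by
  have h1 : SemiconjBy n m (h ^ β * j ^ α * m) := R.mul_nm
  have h2 := (h1.zpow_right d).eq
  rwa [((R.comm_hm.zpow_left β).mul_left (R.comm_jm.zpow_left α)).mul_zpow,
    (R.comm_hj.zpow_zpow β α).mul_zpow, ← zpow_mul, ← zpow_mul] at h2

/-- Each further n must cross the powers of j left by its predecessors, and each crossing produces a
power of h; summing gives the triangular number e(e-1)/2. One step formula, `key`, drives the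
induction in both directions. -/
theorem zpow_n_mul_zpow_m (R : Relations α β γ δ ε h j k m n) (e d : ℤ) :
    n ^ e * m ^ d =
      h ^ (α * γ * d * (e * (e - 1) / 2) + β * e * d) * j ^ (α * e * d) * m ^ d * n ^ e := by
  have key : ∀ e : ℤ,
      n * (h ^ (α * γ * d * (e * (e - 1) / 2) + β * e * d) * j ^ (α * e * d) * m ^ d * n ^ e) =
      h ^ (α * γ * d * ((e + 1) * (e + 1 - 1) / 2) + β * (e + 1) * d) * j ^ (α * (e + 1) * d) *
        m ^ d * n ^ (e + 1) := by
    intro e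
    have e2 : ∀ (b : ℤ) (g : G), n * (j ^ b * g) = h ^ (γ * b) * (j ^ b * (n * g)) := fun b g => by
      have := R.zpow_n_mul_zpow_j 1 b
      rw [zpow_one, mul_one] at this
      rw [← mul_assoc, this]; simp only [mul_assoc]
    have e3 : ∀ g, n * (m ^ d * g) = h ^ (β * d) * (j ^ (α * d) * (m ^ d * (n * g))) := fun g => by
      rw [← mul_assoc, R.n_mul_zpow_m]; simp only [mul_assoc]
    have e4 : ∀ (t : ℤ) (g : G), n * (h ^ t * g) = h ^ t * (n * g) := fun t g => by
      rw [← mul_assoc, (R.comm_hn.symm.zpow_right t).eq, mul_assoc]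
    have e5 : ∀ (s t : ℤ) (g : G), j ^ s * (h ^ t * g) = h ^ t * (j ^ s * g) := fun s t g => by
      rw [← mul_assoc, (R.comm_hj.symm.zpow_zpow s t).eq, mul_assoc]
    have e6 : ∀ (x : G) (s t : ℤ) (g : G), x ^ s * (x ^ t * g) = x ^ (s + t) * g :=
      fun x s t g => by rw [zpow_add, mul_assoc]
    have e7 : n * n ^ e = n ^ (e + 1) := by rw [zpow_add_one, (Commute.self_zpow n e).eq]
    simp only [mul_assoc, e2, e3, e4, e5, e6, e7]
    rw [half_add]
    congr 2
    · norm_num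
      ring
    · congr 2; ring
  induction e using Int.induction_on with
  | zero => simp
  | succ i ih => rw [← key, ← ih, zpow_add_one, (Commute.self_zpow n i).symm.eq, mul_assoc]
  | pred i ih =>
    have := key (-i - 1)
    rw [sub_add_cancel, ← ih] at this
    apply mul_left_cancel (a := n)
    rw [this, ← mul_assoc, ← zpow_one_add]
    congr 2; ring

end Relations

variable {α β γ δ ε : ℤ}

/-- The homomorphism from `H_{5,3}(α, β, γ, δ, ε)` given by five elements satisfying the defining
relations. -/
def lift {G : Type*} [Group G] {h j k m n : G} (R : Relations α β γ δ ε h j k m n) :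
    H53 α β γ δ ε →* G :=
  MonoidHom.mk' (fun x => h ^ x.h * j ^ x.j * k ^ x.k * m ^ x.m * n ^ x.n) <| by
    intro x y
    have a1 : ∀ (e b : ℤ) (g : G), n ^ e * (j ^ b * g) =
        h ^ (γ * e * b) * (j ^ b * (n ^ e * g)) := fun e b g => by
      rw [← mul_assoc, R.zpow_n_mul_zpow_j]; simp only [mul_assoc]
    have a2 : ∀ (e b : ℤ) (g : G), n ^ e * (k ^ b * g) =
        h ^ (ε * e * b) * (k ^ b * (n ^ e * g)) := fun e b g => by
      rw [← mul_assoc, R.zpow_n_mul_zpow_k]; simp only [mul_assoc]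
    have a3 : ∀ (e d : ℤ) (g : G), n ^ e * (m ^ d * g) =
        h ^ (α * γ * d * (e * (e - 1) / 2) + β * e * d) *
          (j ^ (α * e * d) * (m ^ d * (n ^ e * g))) := fun e d g => by
      rw [← mul_assoc, R.zpow_n_mul_zpow_m]; simp only [mul_assoc]
    have a4 : ∀ (e b : ℤ) (g : G), m ^ e * (k ^ b * g) =
        h ^ (δ * e * b) * (k ^ b * (m ^ e * g)) := fun e b g => by
      rw [← mul_assoc, R.zpow_m_mul_zpow_k]; simp only [mul_assoc]
    have comm : ∀ {u v : G}, Commute u v → ∀ (s t : ℤ) (g : G),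
        v ^ s * (u ^ t * g) = u ^ t * (v ^ s * g) := fun {u v} huv s t g => by
      rw [← mul_assoc, (huv.symm.zpow_zpow s t).eq, mul_assoc]
    have add : ∀ (u : G) (s t : ℤ) (g : G), u ^ s * (u ^ t * g) = u ^ (s + t) * g :=
      fun u s t g => by rw [zpow_add, mul_assoc]
    simp only [mul_def, mul_assoc, a1, a2, a3, a4, comm R.comm_hj, comm R.comm_hk, comm R.comm_hm,
      comm R.comm_hn, comm R.comm_jk, comm R.comm_jm, add, ← zpow_add]
    congr 2
    · ring
    · congr 1; ring

theorem lift_apply {G : Type*} [Group G] {h j k m n : G} (R : Relations α β γ δ ε h j k m n)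
    (x : H53 α β γ δ ε) :
    lift R x = h ^ x.h * j ^ x.j * k ^ x.k * m ^ x.m * n ^ x.n := rfl

theorem mk_zpow (a b t : ℤ) :
    (⟨a, b, 0, 0, 0⟩ : H53 α β γ δ ε) ^ t = ⟨t * a, t * b, 0, 0, 0⟩ := by
  induction t using Int.induction_on with
  | zero => simp [one_def]
  | succ i ih => rw [zpow_add_one, ih]; ext <;> simp [mul_def, add_mul]
  | pred i ih => rw [zpow_sub_one, ih]; ext <;> simp [mul_def, inv_def, add_mul, sub_eq_add_neg]

theorem mk_zpow_k (b c t : ℤ) :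
    (⟨0, b, c, 0, 0⟩ : H53 α β γ δ ε) ^ t = ⟨0, t * b, t * c, 0, 0⟩ := by
  induction t using Int.induction_on with
  | zero => simp [one_def]
  | succ i ih => rw [zpow_add_one, ih]; ext <;> simp [mul_def, add_mul]
  | pred i ih => rw [zpow_sub_one, ih]; ext <;> simp [mul_def, inv_def, add_mul, sub_eq_add_neg]

theorem mk_zpow_m (b d t : ℤ) :
    (⟨0, b, 0, d, 0⟩ : H53 α β γ δ ε) ^ t = ⟨0, t * b, 0, t * d, 0⟩ := by
  induction t using Int.induction_on with
  | zero => simp [one_def]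
  | succ i ih => rw [zpow_add_one, ih]; ext <;> simp [mul_def, add_mul]
  | pred i ih => rw [zpow_sub_one, ih]; ext <;> simp [mul_def, inv_def, add_mul, sub_eq_add_neg]

theorem mk_zpow_n (c t : ℤ) : (⟨0, 0, 0, 0, c⟩ : H53 α β γ δ ε) ^ t = ⟨0, 0, 0, 0, t * c⟩ := by
  induction t using Int.induction_on with
  | zero => simp [one_def]
  | succ i ih => rw [zpow_add_one, ih]; ext <;> simp [mul_def, add_mul]
  | pred i ih => rw [zpow_sub_one, ih]; ext <;> simp [mul_def, inv_def, add_mul, sub_eq_add_neg]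

theorem eq_zpow_mul (x : H53 α β γ δ ε) :
    x = (⟨1, 0, 0, 0, 0⟩ : H53 α β γ δ ε) ^ x.h * ⟨0, 1, 0, 0, 0⟩ ^ x.j * ⟨0, 0, 1, 0, 0⟩ ^ x.k *
      ⟨0, 0, 0, 1, 0⟩ ^ x.m * ⟨0, 0, 0, 0, 1⟩ ^ x.n := by
  simp only [mk_zpow, mk_zpow_k, mk_zpow_m, mk_zpow_n]
  ext <;> simp [mul_def]

theorem relations : Relations α β γ δ ε (⟨1, 0, 0, 0, 0⟩ : H53 α β γ δ ε) ⟨0, 1, 0, 0, 0⟩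
    ⟨0, 0, 1, 0, 0⟩ ⟨0, 0, 0, 1, 0⟩ ⟨0, 0, 0, 0, 1⟩ := by
  constructor <;> (try rw [commute_iff_eq]) <;> simp [mk_zpow, mul_def]

theorem Relations.map {G G' : Type*} [Group G] [Group G'] {h j k m n : G}
    (R : Relations α β γ δ ε h j k m n) (f : G →* G') :
    Relations α β γ δ ε (f h) (f j) (f k) (f m) (f n) where
  comm_hj := R.comm_hj.map f
  comm_hk := R.comm_hk.map f
  comm_hm := R.comm_hm.map f
  comm_hn := R.comm_hn.map f
  comm_jk := R.comm_jk.map f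
  comm_jm := R.comm_jm.map f
  mul_nj := by simpa using congrArg f R.mul_nj
  mul_mk := by simpa using congrArg f R.mul_mk
  mul_nk := by simpa using congrArg f R.mul_nk
  mul_nm := by simpa using congrArg f R.mul_nm

theorem eq_top_of_mem {S : Subgroup (H53 α β γ δ ε)} (hh : ⟨1, 0, 0, 0, 0⟩ ∈ S)
    (hj : ⟨0, 1, 0, 0, 0⟩ ∈ S) (hk : ⟨0, 0, 1, 0, 0⟩ ∈ S) (hm : ⟨0, 0, 0, 1, 0⟩ ∈ S)
    (hn : ⟨0, 0, 0, 0, 1⟩ ∈ S) : S = ⊤ := by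
  refine (Subgroup.eq_top_iff' S).2 fun x => ?_
  rw [eq_zpow_mul x]
  exact S.mul_mem (S.mul_mem (S.mul_mem (S.mul_mem (S.zpow_mem hh _) (S.zpow_mem hj _))
    (S.zpow_mem hk _)) (S.zpow_mem hm _)) (S.zpow_mem hn _)

/-- A nontrivial normal subgroup of `H_{5,3}(α, β, γ, δ, ε)` meets the center. -/
theorem injective_of_center {G : Type*} [Group G] (hγ : γ ≠ 0) (hδ : δ ≠ 0)
    (f : H53 α β γ δ ε →* G) (hf : ∀ t : ℤ, f ⟨t, 0, 0, 0, 0⟩ = 1 → t = 0) :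
    Function.Injective f := by
  rw [injective_iff_map_eq_one]
  intro x hx
  -- The kernel contains every commutator of `x`. Testing against j, k, m, n in this order kills the
  -- coordinates n, m, k, j in turn, each commutator being central once the previous ones vanish.
  have comm : ∀ (y : H53 α β γ δ ε) (t : ℤ), x * y = ⟨t, 0, 0, 0, 0⟩ * (y * x) → t = 0 := by
    intro y t e
    have := congrArg f e
    simp only [map_mul, hx, one_mul, mul_one] at this
    exact hf t (by simpa using this.symm)
  have hn : x.n = 0 := by
    have := comm ⟨0, 1, 0, 0, 0⟩ (γ * x.n) (by ext <;> simp [mul_def] <;> ring)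
    simpa [hγ] using this
  have hm : x.m = 0 := by
    have := comm ⟨0, 0, 1, 0, 0⟩ (δ * x.m) (by ext <;> simp [mul_def, hn] <;> ring)
    simpa [hδ] using this
  have hk : x.k = 0 := by
    have := comm ⟨0, 0, 0, 1, 0⟩ (-(δ * x.k)) (by ext <;> simp [mul_def, hn, hm])
    simpa [hδ] using this
  have hj : x.j = 0 := by
    have := comm ⟨0, 0, 0, 0, 1⟩ (-(γ * x.j)) (by ext <;> simp [mul_def, hn, hm, hk])
    simpa [hγ] using this
  obtain ⟨h, j, k, m, n⟩ := x
  simp only at hn hm hk hj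
  subst hn hm hk hj
  rw [hf h hx]; rfl

end H53

/-! ### Normalizing the parameters -/

theorem Int.exists_sign_mul_add_le_half (x : ℤ) {g : ℤ} (hg : 0 < g) :
    ∃ σ q : ℤ, (σ = 1 ∨ σ = -1) ∧ 0 ≤ σ * x + q * g ∧ 2 * (σ * x + q * g) ≤ g := by
  have h1 := Int.emod_add_mul_ediv x g
  have h2 := Int.emod_nonneg x hg.ne'
  have h3 := Int.emod_lt_of_pos x hg
  by_cases h : 2 * (x % g) ≤ g
  · refine ⟨1, -(x / g), Or.inl rfl, ?_, ?_⟩ <;> linarith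
  · refine ⟨-1, x / g + 1, Or.inr rfl, ?_, ?_⟩ <;> linarith

theorem Int.exists_sign_mul_pos {x : ℤ} (hx : x ≠ 0) : ∃ σ : ℤ, σ * σ = 1 ∧ 0 < x * σ := by
  rcases lt_or_gt_of_ne hx with h | h
  · exact ⟨-1, by norm_num, by linarith⟩
  · exact ⟨1, by norm_num, by linarith⟩

namespace H53

variable {α β γ δ ε : ℤ}

/-- A triangular change of generators with diagonal entries `±1`. -/
theorem nonempty_mulEquiv_of_change {α' β' γ' δ' ε' : ℤ} (hγ : γ' ≠ 0) (hδ : δ' ≠ 0)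
    {s u v w t c b d e f a : ℤ} (hs : s * s = 1) (hu : u * u = 1) (hv : v * v = 1)
    (hw : w * w = 1) (ht : t * t = 1) (eα : α' * u = α * t * w) (eγ : γ' * s = γ * t * u)
    (eδ : δ' * s = δ * w * v) (eε : ε' * s = γ * t * b + δ * a * v + ε * t * v)
    (eβ : β' * s + α' * c + δ * w * f =
      γ * t * d + α * γ * w * (t * (t - 1) / 2) + β * t * w + δ * a * e + ε * t * e) :
    Nonempty (H53 α β γ δ ε ≃* H53 α' β' γ' δ' ε') := by
  have R : Relations α' β' γ' δ' ε' (⟨s, 0, 0, 0, 0⟩ : H53 α β γ δ ε) ⟨c, u, 0, 0, 0⟩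
      ⟨0, b, v, 0, 0⟩ ⟨0, d, e, w, 0⟩ ⟨0, 0, f, a, t⟩ := by
    constructor <;> (try rw [commute_iff_eq]) <;> ext <;> simp [mk_zpow, mul_def] <;>
      linarith
  have inj : Function.Injective (lift R) := by
    refine injective_of_center hγ hδ _ fun x hx => ?_
    have hx' : x * s = 0 := by
      simpa [lift_apply, mk_zpow, mul_def, one_def] using congrArg H53.h hx
    calc x = x * s * s := by rw [mul_assoc, hs, mul_one]
      _ = 0 := by rw [hx', zero_mul]
  have top : (lift R).range = ⊤ := by
    have Sh : (⟨s, 0, 0, 0, 0⟩ : H53 α β γ δ ε) ∈ (lift R).range :=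
      ⟨⟨1, 0, 0, 0, 0⟩, by simp [lift_apply]⟩
    have Sj : (⟨c, u, 0, 0, 0⟩ : H53 α β γ δ ε) ∈ (lift R).range :=
      ⟨⟨0, 1, 0, 0, 0⟩, by simp [lift_apply]⟩
    have Sk : (⟨0, b, v, 0, 0⟩ : H53 α β γ δ ε) ∈ (lift R).range :=
      ⟨⟨0, 0, 1, 0, 0⟩, by simp [lift_apply]⟩
    have Sm : (⟨0, d, e, w, 0⟩ : H53 α β γ δ ε) ∈ (lift R).range :=
      ⟨⟨0, 0, 0, 1, 0⟩, by simp [lift_apply]⟩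
    have Sn : (⟨0, 0, f, a, t⟩ : H53 α β γ δ ε) ∈ (lift R).range :=
      ⟨⟨0, 0, 0, 0, 1⟩, by simp [lift_apply]⟩
    -- The triangular system is inverted from the center upwards; each diagonal entry is its own
    -- inverse.
    generalize (lift R).range = S at *
    have Th (x : ℤ) : (⟨x, 0, 0, 0, 0⟩ : H53 α β γ δ ε) ∈ S := by
      convert S.zpow_mem Sh (x * s) using 1
      ext <;> simp [mk_zpow, mul_assoc, hs]
    have Tj (x : ℤ) : (⟨0, x, 0, 0, 0⟩ : H53 α β γ δ ε) ∈ S := by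
      convert S.mul_mem (Th (-(x * u * c))) (S.zpow_mem Sj (x * u)) using 1
      ext <;> simp [mk_zpow, mul_def, mul_assoc, hu]
    have Tk (x : ℤ) : (⟨0, 0, x, 0, 0⟩ : H53 α β γ δ ε) ∈ S := by
      have : (⟨0, 0, v, 0, 0⟩ : H53 α β γ δ ε) ∈ S := by
        convert S.mul_mem (Tj (-b)) Sk using 1
        ext <;> simp [mul_def]
      convert S.zpow_mem this (x * v) using 1
      ext <;> simp [mk_zpow_k, mul_assoc, hv]
    have Tm (x : ℤ) : (⟨0, 0, 0, x, 0⟩ : H53 α β γ δ ε) ∈ S := by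
      have : (⟨0, 0, 0, w, 0⟩ : H53 α β γ δ ε) ∈ S := by
        convert S.mul_mem (S.mul_mem (Tj (-d)) (Tk (-e))) Sm using 1
        ext <;> simp [mul_def]
      convert S.zpow_mem this (x * w) using 1
      ext <;> simp [mk_zpow_m, mul_assoc, hw]
    refine eq_top_of_mem (Th 1) (Tj 1) (Tk 1) (Tm 1) ?_
    have : (⟨0, 0, 0, 0, t⟩ : H53 α β γ δ ε) ∈ S := by
      convert S.mul_mem (Tm (-a)) (S.mul_mem (Tk (-f)) Sn) using 1
      ext <;> simp [mul_def]
    convert S.zpow_mem this t using 1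
    ext <;> simp [mk_zpow_n, ht]
  exact ⟨(MulEquiv.ofBijective (lift R) ⟨inj, MonoidHom.range_eq_top.1 top⟩).symm⟩

/-- Every `H_{5,3}(α, β, γ, δ, ε)` with `α, γ, δ ≠ 0` is isomorphic to an admissible one. -/
theorem exists_admissible (hα : α ≠ 0) (hγ : γ ≠ 0) (hδ : δ ≠ 0) :
    ∃ α' β' γ' δ' ε' : ℤ, Admissible α' β' γ' δ' ε' ∧
      Nonempty (H53 α β γ δ ε ≃* H53 α' β' γ' δ' ε') := by
  obtain ⟨α₁, β₁, γ₁, δ₁, ε₁, hα₁, hγ₁, hδ₁, ⟨φ⟩⟩ : ∃ α' β' γ' δ' ε' : ℤ,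
      0 < α' ∧ 0 < γ' ∧ 0 < δ' ∧ Nonempty (H53 α β γ δ ε ≃* H53 α' β' γ' δ' ε') := by
    obtain ⟨u, hu, pu⟩ := Int.exists_sign_mul_pos hα
    have hu0 : u ≠ 0 := by rintro rfl; simp at hu
    obtain ⟨s, hs, ps⟩ := Int.exists_sign_mul_pos (mul_ne_zero hγ hu0)
    have hs0 : s ≠ 0 := by rintro rfl; simp at hs
    obtain ⟨v, hv, pv⟩ := Int.exists_sign_mul_pos (mul_ne_zero hδ hs0)
    refine ⟨α * u, β * s, γ * u * s, δ * s * v, ε * s * v, pu, ps, pv,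
      nonempty_mulEquiv_of_change ps.ne' pv.ne' (t := 1) (w := 1) (c := 0) (b := 0) (d := 0)
        (e := 0) (f := 0) (a := 0) hs hu hv rfl rfl ?_ ?_ ?_ ?_ ?_⟩
    · linear_combination α * hu
    · linear_combination γ * u * hs
    · linear_combination δ * v * hs
    · linear_combination ε * v * hs
    · norm_num
      linear_combination β * hs
  have hg : 0 < (Int.gcd γ₁ δ₁ : ℤ) := by
    exact_mod_cast Int.gcd_pos_of_ne_zero_left _ hγ₁.ne'
  obtain ⟨σ, q, hσ, e0, e1⟩ := Int.exists_sign_mul_add_le_half ε₁ hg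
  rw [Int.gcd_eq_gcd_ab γ₁ δ₁] at e0 e1
  obtain ⟨ε₂, e0, e1, ⟨φ₂⟩⟩ : ∃ ε₂ : ℤ, 0 ≤ ε₂ ∧ 2 * ε₂ ≤ (Int.gcd γ₁ δ₁ : ℤ) ∧
      Nonempty (H53 α₁ β₁ γ₁ δ₁ ε₁ ≃* H53 α₁ β₁ γ₁ δ₁ ε₂) := by
    -- By `eε`, `b` shifts ε by multiples of γ and `a` by multiples of δ, so Bézout coefficients
    -- realize the shift by q·gcd. Taking s = u = w = σ changes the sign of ε and keeps α, γ, δ.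
    refine ⟨_, e0, by rwa [Int.gcd_eq_gcd_ab γ₁ δ₁],
      nonempty_mulEquiv_of_change hγ₁.ne' hδ₁.ne' (s := σ) (u := σ) (v := 1) (w := σ) (t := 1)
        (c := 0) (b := σ * q * γ₁.gcdA δ₁) (d := 0) (e := 0) (f := 0) (a := σ * q * γ₁.gcdB δ₁)
        ?_ ?_ ?_ ?_ ?_ ?_ ?_ ?_ ?_ ?_⟩ <;> rcases hσ with rfl | rfl <;> norm_num <;> ring
  have hg' : 0 < (Int.gcd α₁ (Int.gcd γ₁ (Int.gcd δ₁ ε₂)) : ℤ) := by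
    exact_mod_cast Int.gcd_pos_of_ne_zero_left _ hα₁.ne'
  obtain ⟨τ, r, hτ, b0, b1⟩ := Int.exists_sign_mul_add_le_half β₁ hg'
  obtain ⟨x₁, x₂, x₃, x₄, hx⟩ : ∃ x₁ x₂ x₃ x₄ : ℤ,
      (Int.gcd α₁ (Int.gcd γ₁ (Int.gcd δ₁ ε₂)) : ℤ) =
        α₁ * x₁ + γ₁ * x₂ + δ₁ * x₃ + ε₂ * x₄ := by
    have h1 := Int.gcd_eq_gcd_ab α₁ (Int.gcd γ₁ (Int.gcd δ₁ ε₂))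
    have h2 := Int.gcd_eq_gcd_ab γ₁ (Int.gcd δ₁ ε₂)
    have h3 := Int.gcd_eq_gcd_ab δ₁ ε₂
    set B₁ := Int.gcdB α₁ (Int.gcd γ₁ (Int.gcd δ₁ ε₂))
    set B₂ := Int.gcdB γ₁ (Int.gcd δ₁ ε₂)
    exact ⟨Int.gcdA α₁ (Int.gcd γ₁ (Int.gcd δ₁ ε₂)), Int.gcdA γ₁ (Int.gcd δ₁ ε₂) * B₁,
      Int.gcdA δ₁ ε₂ * B₂ * B₁, Int.gcdB δ₁ ε₂ * B₂ * B₁,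
      by linear_combination h1 + B₁ * h2 + B₁ * B₂ * h3⟩
  obtain ⟨β₂, b0, b1, ⟨φ₃⟩⟩ : ∃ β₂ : ℤ, 0 ≤ β₂ ∧
      2 * β₂ ≤ (Int.gcd α₁ (Int.gcd γ₁ (Int.gcd δ₁ ε₂)) : ℤ) ∧
      Nonempty (H53 α₁ β₁ γ₁ δ₁ ε₂ ≃* H53 α₁ β₂ γ₁ δ₁ ε₂) := by
    refine ⟨_, b0, b1, ?_⟩
    rw [hx]
    rcases hτ with rfl | rfl
    -- By `eβ`, the entries `c`, `d`, `f`, `e` shift β by multiples of α, γ, δ, ε respectively.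
    · refine nonempty_mulEquiv_of_change hγ₁.ne' hδ₁.ne' (s := 1) (u := 1) (v := 1) (w := 1)
        (t := 1) (c := -(r * x₁)) (b := 0) (d := r * x₂) (e := r * x₄) (f := -(r * x₃)) (a := 0)
        ?_ ?_ ?_ ?_ ?_ ?_ ?_ ?_ ?_ ?_ <;> (norm_num; try ring)
    -- With t = -1 the triangular number t(t-1)/2 is 1; the extra -γ in `c` cancels the resulting
    -- αγ.
    · refine nonempty_mulEquiv_of_change hγ₁.ne' hδ₁.ne' (s := -1) (u := 1) (v := 1) (w := -1)
        (t := -1) (c := r * x₁ - γ₁) (b := 0) (d := r * x₂) (e := r * x₄) (f := -(r * x₃)) (a := 0)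
        ?_ ?_ ?_ ?_ ?_ ?_ ?_ ?_ ?_ ?_ <;> (norm_num; try ring)
  refine ⟨α₁, β₂, γ₁, δ₁, ε₂, ⟨hα₁, hγ₁, hδ₁, e0, ?_, b0, ?_⟩,
    ⟨(φ.trans φ₂).trans φ₃⟩⟩
  · rw [le_div_iff₀ two_pos, mul_comm]
    exact_mod_cast e1
  · rw [le_div_iff₀ two_pos, mul_comm]
    exact_mod_cast b1

end H53

/-! ### Structure of subgroups of the Lie group -/

theorem Subgroup.mem_of_mul_eq_mul_mul {G : Type*} [Group G] {S : Subgroup G} {x y z : G}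
    (hx : x ∈ S) (hy : y ∈ S) (h : x * y = z * (y * x)) : z ∈ S := by
  have : z = x * y * (y * x)⁻¹ := by rw [h, mul_inv_cancel_right]
  exact this ▸ S.mul_mem (S.mul_mem hx hy) (S.inv_mem (S.mul_mem hy hx))

namespace G53

@[simp] theorem mul_k (x y : G53) : (x * y).k = x.k + y.k := rfl
@[simp] theorem mul_m (x y : G53) : (x * y).m = x.m + y.m := rfl
@[simp] theorem mul_n (x y : G53) : (x * y).n = x.n + y.n := rfl
@[simp] theorem inv_k (x : G53) : (x⁻¹).k = -x.k := rfl
@[simp] theorem inv_m (x : G53) : (x⁻¹).m = -x.m := rfl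
@[simp] theorem inv_n (x : G53) : (x⁻¹).n = -x.n := rfl
@[simp] theorem one_k : (1 : G53).k = 0 := rfl
@[simp] theorem one_m : (1 : G53).m = 0 := rfl
@[simp] theorem one_n : (1 : G53).n = 0 := rfl

@[simp] theorem zpow_k (x : G53) (t : ℤ) : (x ^ t).k = t * x.k := by
  induction t using Int.induction_on with
  | zero => simp
  | succ i ih => rw [zpow_add_one, mul_k, ih]; push_cast; ring
  | pred i ih => rw [zpow_sub_one, mul_k, ih]; push_cast; simp; ring

@[simp] theorem zpow_m (x : G53) (t : ℤ) : (x ^ t).m = t * x.m := by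
  induction t using Int.induction_on with
  | zero => simp
  | succ i ih => rw [zpow_add_one, mul_m, ih]; push_cast; ring
  | pred i ih => rw [zpow_sub_one, mul_m, ih]; push_cast; simp; ring

@[simp] theorem zpow_n (x : G53) (t : ℤ) : (x ^ t).n = t * x.n := by
  induction t using Int.induction_on with
  | zero => simp
  | succ i ih => rw [zpow_add_one, mul_n, ih]; push_cast; ring
  | pred i ih => rw [zpow_sub_one, mul_n, ih]; push_cast; simp; ring

theorem mk_zpow (a b : ℝ) (t : ℤ) : (⟨a, b, 0, 0, 0⟩ : G53) ^ t = ⟨t * a, t * b, 0, 0, 0⟩ := by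
  induction t using Int.induction_on with
  | zero => simp [one_def]
  | succ i ih => rw [zpow_add_one, ih]; ext <;> simp [mul_def, add_mul]
  | pred i ih => rw [zpow_sub_one, ih]; ext <;> simp [mul_def, inv_def, add_mul, sub_eq_add_neg]

/-- The subgroup of elements whose `n`-coordinate vanishes. -/
def subgroupM : Subgroup G53 where
  carrier := {x | x.n = 0}
  one_mem' := rfl
  mul_mem' hx hy := by simp_all
  inv_mem' hx := by simp_all

/-- The subgroup of elements whose `m`- and `n`-coordinates vanish. -/
def subgroupK : Subgroup G53 where
  carrier := {x | x.m = 0 ∧ x.n = 0}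
  one_mem' := ⟨rfl, rfl⟩
  mul_mem' hx hy := by simp_all
  inv_mem' hx := by simp_all

/-- The subgroup of elements whose `j`-, `k`-, `m`- and `n`-coordinates vanish. -/
def subgroupH : Subgroup G53 where
  carrier := {x | x.j = 0 ∧ x.k = 0 ∧ x.m = 0 ∧ x.n = 0}
  one_mem' := ⟨rfl, rfl, rfl, rfl⟩
  mul_mem' hx hy := by simp_all [mul_def]
  inv_mem' hx := by simp_all [inv_def]

/-- The subgroup of elements whose `k`-, `m`- and `n`-coordinates vanish. -/
def subgroupJ : Subgroup G53 where
  carrier := {x | x.k = 0 ∧ x.m = 0 ∧ x.n = 0}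
  one_mem' := ⟨rfl, rfl, rfl⟩
  mul_mem' hx hy := by simp_all
  inv_mem' hx := by simp_all

theorem mem_subgroupM {x : G53} : x ∈ subgroupM ↔ x.n = 0 := Iff.rfl
theorem mem_subgroupK {x : G53} : x ∈ subgroupK ↔ x.m = 0 ∧ x.n = 0 := Iff.rfl
theorem mem_subgroupJ {x : G53} : x ∈ subgroupJ ↔ x.k = 0 ∧ x.m = 0 ∧ x.n = 0 := Iff.rfl

/-- On `K` the map `f` is a homomorphism into the cyclic group ℤd, so its image is cyclic; `x₀` is a
preimage of a generator. -/
theorem exists_generator (K : Subgroup G53) (f : G53 → ℝ)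
    (hf : ∀ x ∈ K, ∀ y ∈ K, f (x * y) = f x + f y) (d : ℝ) (hd : ∀ x ∈ K, ∃ z : ℤ, f x = z * d)
    (ne : ∃ x ∈ K, f x ≠ 0) :
    ∃ x₀ ∈ K, f x₀ ≠ 0 ∧ ∀ x ∈ K, ∃ z : ℤ, f x = z * f x₀ := by
  have f1 : f 1 = 0 := by simpa using hf 1 K.one_mem 1 K.one_mem
  have finv : ∀ x ∈ K, f x⁻¹ = -f x := fun x hx => by
    have := hf x hx x⁻¹ (K.inv_mem hx)
    rw [mul_inv_cancel, f1] at this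
    linarith
  let S : AddSubgroup ℤ :=
    { carrier := {z | ∃ x ∈ K, f x = z * d}
      zero_mem' := ⟨1, K.one_mem, by simp [f1]⟩
      add_mem' := by
        rintro a b ⟨x, hx, ex⟩ ⟨y, hy, ey⟩
        exact ⟨x * y, K.mul_mem hx hy, by rw [hf x hx y hy, ex, ey]; push_cast; ring⟩
      neg_mem' := by
        rintro a ⟨x, hx, ex⟩
        exact ⟨x⁻¹, K.inv_mem hx, by rw [finv x hx, ex]; push_cast; ring⟩ }
  obtain ⟨g, hg⟩ := Int.subgroup_cyclic S
  rw [← AddSubgroup.zmultiples_eq_closure] at hg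
  obtain ⟨x₀, hx₀, e₀⟩ : g ∈ S := hg ▸ AddSubgroup.mem_zmultiples g
  have gen : ∀ x ∈ K, ∃ z : ℤ, f x = z * f x₀ := fun x hx => by
    obtain ⟨z, hz⟩ := hd x hx
    have : z ∈ S := ⟨x, hx, hz⟩
    rw [hg, AddSubgroup.mem_zmultiples_iff] at this
    obtain ⟨q, rfl⟩ := this
    exact ⟨q, by rw [hz, e₀, smul_eq_mul]; push_cast; ring⟩
  refine ⟨x₀, hx₀, fun h0 => ?_, gen⟩
  obtain ⟨x, hx, hne⟩ := ne
  obtain ⟨z, hz⟩ := gen x hx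
  exact hne (by rw [hz, h0, mul_zero])

/-- A subgroup of `G_{5,3}` meeting the center in a cyclic group, with elements having each
coordinate as nonzero leading coordinate, is one of the groups `H_{5,3}(α, β, γ, δ, ε)`. -/
theorem exists_mulEquiv_H53 {Γ : Subgroup G53} {c : ℝ}
    (hc : ∀ t : ℝ, ⟨t, 0, 0, 0, 0⟩ ∈ Γ → ∃ z : ℤ, t = z * c)
    (hj : ∃ x ∈ Γ ⊓ subgroupJ, x.j ≠ 0) (hk : ∃ x ∈ Γ ⊓ subgroupK, x.k ≠ 0)
    (hm : ∃ x ∈ Γ ⊓ subgroupM, x.m ≠ 0) (hn : ∃ x ∈ Γ, x.n ≠ 0) :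
    ∃ α β γ δ ε : ℤ, H53.Admissible α β γ δ ε ∧ Nonempty (Γ ≃* H53 α β γ δ ε) := by
  have center : ∀ x ∈ Γ, ∀ y ∈ Γ, ∀ t : ℝ, x * y = ⟨t, 0, 0, 0, 0⟩ * (y * x) →
      ∃ z : ℤ, t = z * c := fun x hx y hy t e =>
    hc t (Subgroup.mem_of_mul_eq_mul_mul hx hy e)
  -- A commutator with one fixed element turns the coordinate in question into one already known to
  -- be discrete. Hence the order: j (paired with an element with n ≠ 0), n (with j), m (with n,
  -- landing in j), k (with m).
  obtain ⟨j, ⟨hjΓ, hj1, hj2, hj3⟩, hj0, genj⟩ : ∃ x₀ ∈ Γ ⊓ subgroupJ, x₀.j ≠ 0 ∧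
      ∀ x ∈ Γ ⊓ subgroupJ, ∃ z : ℤ, x.j = z * x₀.j := by
    obtain ⟨y, hy, hy0⟩ := hn
    refine exists_generator _ _ (fun x hx z hz => ?_) (c / y.n) (fun x hx => ?_) hj
    · have := hx.2.2.2
      simp [mul_def, this]
    · obtain ⟨hx, h1, h2, h3⟩ := hx
      obtain ⟨z, hz⟩ := center y hy x hx (y.n * x.j) (by
        ext <;> simp [mul_def, h1, h2, h3] <;> ring)
      exact ⟨z, by field_simp; linarith⟩
  obtain ⟨n, hnΓ, hn0, genn⟩ : ∃ x₀ ∈ Γ, x₀.n ≠ 0 ∧ ∀ x ∈ Γ, ∃ z : ℤ, x.n = z * x₀.n := by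
    refine exists_generator _ _ (fun _ _ _ _ => rfl) (c / j.j) (fun x hx => ?_) hn
    obtain ⟨z, hz⟩ := center x hx j hjΓ (x.n * j.j) (by
      ext <;> simp [mul_def, hj1, hj2, hj3] <;> ring)
    exact ⟨z, by field_simp; linarith⟩
  have ha : ∀ x ∈ Γ, n * x * (x * n)⁻¹ ∈ Γ := fun x hx =>
    Γ.mul_mem (Γ.mul_mem hnΓ hx) (Γ.inv_mem (Γ.mul_mem hx hnΓ))
  have hcomm : ∀ x ∈ Γ ⊓ subgroupM, n * x * (x * n)⁻¹ ∈ Γ ⊓ subgroupJ := fun x hx =>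
    ⟨ha x hx.1, by simp; ring, by simp; ring, by simp; ring⟩
  have jcomm : ∀ x ∈ subgroupM, (n * x * (x * n)⁻¹).j = n.n * x.m := fun x hx => by
    rw [mem_subgroupM] at hx
    simp [mul_def, inv_def, hx]; ring
  obtain ⟨m, ⟨hmΓ, hm1⟩, hm0, genm⟩ : ∃ x₀ ∈ Γ ⊓ subgroupM, x₀.m ≠ 0 ∧
      ∀ x ∈ Γ ⊓ subgroupM, ∃ z : ℤ, x.m = z * x₀.m := by
    refine exists_generator _ _ (fun _ _ _ _ => rfl) (j.j / n.n) (fun x hx => ?_) hm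
    obtain ⟨z, hz⟩ := genj _ (hcomm x hx)
    rw [jcomm x hx.2] at hz
    exact ⟨z, by field_simp; linarith⟩
  replace hm1 : m.n = 0 := hm1
  obtain ⟨k, ⟨hkΓ, hk1, hk2⟩, hk0, genk⟩ : ∃ x₀ ∈ Γ ⊓ subgroupK, x₀.k ≠ 0 ∧
      ∀ x ∈ Γ ⊓ subgroupK, ∃ z : ℤ, x.k = z * x₀.k := by
    refine exists_generator _ _ (fun _ _ _ _ => rfl) (c / m.m) (fun x hx => ?_) hk
    obtain ⟨hx, h1, h2⟩ := hx
    obtain ⟨z, hz⟩ := center m hmΓ x hx (m.m * x.k) (by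
      ext <;> simp [mul_def, h1, h2, hm1] <;> ring)
    exact ⟨z, by field_simp; linarith⟩
  obtain ⟨h, ⟨hhΓ, hh1, hh2, hh3, hh4⟩, hh0, genh⟩ : ∃ x₀ ∈ Γ ⊓ subgroupH, x₀.h ≠ 0 ∧
      ∀ x ∈ Γ ⊓ subgroupH, ∃ z : ℤ, x.h = z * x₀.h := by
    refine exists_generator _ _ (fun x hx y hy => ?_) c (fun x hx => ?_)
      ⟨n * j * (j * n)⁻¹, ⟨ha j hjΓ, ?_⟩, ?_⟩
    · obtain ⟨-, -, -, h3, h4⟩ := hx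
      simp [mul_def, h3, h4]
    · obtain ⟨hx, h1, h2, h3, h4⟩ := hx
      refine hc _ ?_
      have : x = ⟨x.h, 0, 0, 0, 0⟩ := by ext <;> simp_all
      exact this ▸ hx
    · have := jcomm j hj3
      refine ⟨?_, ?_, ?_, ?_⟩ <;> simp_all
    · have : (n * j * (j * n)⁻¹).h = n.n * j.j := by
        simp [mul_def, inv_def, hj1, hj2, hj3]; ring
      rw [this]
      exact mul_ne_zero hn0 hj0
  obtain ⟨h₁, rfl⟩ : ∃ t, h = ⟨t, 0, 0, 0, 0⟩ := ⟨h.h, by ext <;> simp [*]⟩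
  obtain ⟨h₂, j₂, rfl⟩ : ∃ s t, j = ⟨s, t, 0, 0, 0⟩ := ⟨j.h, j.j, by ext <;> simp [*]⟩
  obtain ⟨h₃, j₃, k₃, rfl⟩ : ∃ s t u, k = ⟨s, t, u, 0, 0⟩ :=
    ⟨k.h, k.j, k.k, by ext <;> simp [*]⟩
  obtain ⟨h₄, j₄, k₄, m₄, rfl⟩ : ∃ s t u v, m = ⟨s, t, u, v, 0⟩ :=
    ⟨m.h, m.j, m.k, m.m, by ext <;> simp [*]⟩
  clear hj1 hj2 hj3 hk1 hk2 hh1 hh2 hh3 hh4 hm1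
  simp only at hh0 hj0 hk0 hm0
  have cgen : ∀ x ∈ Γ, ∀ y ∈ Γ, ∀ t : ℝ, x * y = ⟨t, 0, 0, 0, 0⟩ * (y * x) →
      ∃ z : ℤ, t = z * h₁ := fun x hx y hy t e =>
    genh ⟨t, 0, 0, 0, 0⟩ ⟨Subgroup.mem_of_mul_eq_mul_mul hx hy e, rfl, rfl, rfl, rfl⟩
  obtain ⟨γ, hγ⟩ := cgen _ hnΓ _ hjΓ (n.n * j₂) (by ext <;> simp [mul_def] <;> ring)
  obtain ⟨δ, hδ⟩ := cgen _ hmΓ _ hkΓ (m₄ * k₃) (by ext <;> simp [mul_def] <;> ring)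
  obtain ⟨ε, hε⟩ := cgen _ hnΓ _ hkΓ (n.n * j₃ + n.m * k₃) (by ext <;> simp [mul_def] <;> ring)
  obtain ⟨α, hα⟩ := genj _ (hcomm _ ⟨hmΓ, rfl⟩)
  rw [jcomm _ rfl] at hα
  simp only at hα
  -- This is the central factor left when n m is compared with j^α m n.
  obtain ⟨β, hβ⟩ : ∃ z : ℤ,
      -α * h₂ + n.n * j₄ + m₄ * (n.n * (n.n - 1) / 2) + n.m * k₄ - m₄ * n.k = z * h₁ := by
    refine genh ⟨_, 0, 0, 0, 0⟩ ⟨?_, rfl, rfl, rfl, rfl⟩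
    refine (Subgroup.mul_mem_cancel_right Γ (Γ.mul_mem (Γ.zpow_mem hjΓ α)
      (Γ.mul_mem hmΓ hnΓ))).1 ?_
    convert Γ.mul_mem hnΓ hmΓ using 1
    rw [mk_zpow]
    ext <;> simp [mul_def] <;> linarith
  have hα0 : α ≠ 0 := by
    rintro rfl
    simp [hn0, hm0] at hα
  have hγ0 : γ ≠ 0 := by
    rintro rfl
    simp [hn0, hj0] at hγ
  have hδ0 : δ ≠ 0 := by
    rintro rfl
    simp [hm0, hk0] at hδ
  obtain ⟨α', β', γ', δ', ε', hadm, ⟨φ⟩⟩ :=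
    H53.exists_admissible (β := β) (ε := ε) hα0 hγ0 hδ0
  refine ⟨α', β', γ', δ', ε', hadm, ⟨MulEquiv.trans ?_ φ⟩⟩
  have R : H53.Relations α β γ δ ε (⟨h₁, 0, 0, 0, 0⟩ : G53) ⟨h₂, j₂, 0, 0, 0⟩
      ⟨h₃, j₃, k₃, 0, 0⟩ ⟨h₄, j₄, k₄, m₄, 0⟩ n := by
    constructor <;> (try rw [commute_iff_eq]) <;> ext <;> simp [mk_zpow, mul_def] <;>
      linarith
  have inj : Function.Injective (H53.lift R) := by
    refine H53.injective_of_center hγ0 hδ0 _ fun x hx => ?_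
    simpa [H53.lift_apply, mk_zpow, mul_def, one_def, hh0] using congrArg G53.h hx
  have range : (H53.lift R).range = Γ := by
    apply le_antisymm
    · rintro _ ⟨x, rfl⟩
      exact Γ.mul_mem (Γ.mul_mem (Γ.mul_mem (Γ.mul_mem (Γ.zpow_mem hhΓ _) (Γ.zpow_mem hjΓ _))
        (Γ.zpow_mem hkΓ _)) (Γ.zpow_mem hmΓ _)) (Γ.zpow_mem hnΓ _)
    · intro x hx
      -- Successive division on the right by powers of n, m, k, j leaves a central element.
      obtain ⟨e, he⟩ := genn x hx
      have x₁Γ := Γ.mul_mem hx (Γ.inv_mem (Γ.zpow_mem hnΓ e))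
      obtain ⟨d, hd⟩ := genm _ ⟨x₁Γ, by simp [mem_subgroupM, he]⟩
      have x₂Γ := Γ.mul_mem x₁Γ (Γ.inv_mem (Γ.zpow_mem hmΓ d))
      obtain ⟨c, hc⟩ := genk _ ⟨x₂Γ, by rw [mul_m, hd]; simp, by simp [he]⟩
      have x₃Γ := Γ.mul_mem x₂Γ (Γ.inv_mem (Γ.zpow_mem hkΓ c))
      generalize ex : x * (n ^ e)⁻¹ * (⟨h₄, j₄, k₄, m₄, 0⟩ ^ d)⁻¹ *
        (⟨h₃, j₃, k₃, 0, 0⟩ ^ c)⁻¹ = y at x₃Γ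
      have yn : y.n = 0 := by simp [← ex, he]
      have ym : y.m = 0 := by rw [← ex, mul_m, mul_m, hd]; simp
      have yk : y.k = 0 := by rw [← ex, mul_k, hc]; simp
      obtain ⟨b, hb⟩ := genj y ⟨x₃Γ, yk, ym, yn⟩
      obtain ⟨a, ha⟩ := genh _ ⟨Γ.mul_mem x₃Γ (Γ.inv_mem (Γ.zpow_mem hjΓ b)), by
        rw [mk_zpow]; simp [mul_def, inv_def, yn, hb], by simp [yk], by simp [ym], by simp [yn]⟩
      rw [mk_zpow] at ha
      simp only [mul_def, inv_def, yn] at ha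
      have hy : y = ⟨h₁, 0, 0, 0, 0⟩ ^ a * ⟨h₂, j₂, 0, 0, 0⟩ ^ b := by
        ext <;> simp [mk_zpow, mul_def, yk, ym, yn, hb]
        linarith
      rw [hy, mul_inv_eq_iff_eq_mul, mul_inv_eq_iff_eq_mul, mul_inv_eq_iff_eq_mul] at ex
      exact ⟨⟨a, b, c, d, e⟩, ex.symm⟩
  exact (MulEquiv.subgroupCongr range).symm.trans (MonoidHom.ofInjective inj).symm

end G53

/-! ### Discrete cocompact subgroups and finite-index subgroups of the lattice -/

theorem Real.finite_setOf_intCast_mul_abs_lt (d C : ℝ) :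
    {x : ℝ | (∃ z : ℤ, x = z * d) ∧ |x| < C}.Finite := by
  rcases eq_or_ne d 0 with rfl | hd
  · refine (Set.finite_singleton 0).subset ?_
    rintro x ⟨⟨z, rfl⟩, -⟩
    simp
  · refine ((Set.finite_Icc (-⌈C / |d|⌉) ⌈C / |d|⌉).image fun z : ℤ => (z : ℝ) * d).subset ?_
    rintro x ⟨⟨z, rfl⟩, hx⟩
    refine ⟨z, ?_, rfl⟩
    have hd' : 0 < |d| := abs_pos.2 hd
    rw [abs_mul, ← lt_div_iff₀ hd'] at hx
    rw [Set.mem_Icc, ← abs_le]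
    exact_mod_cast (hx.le.trans (Int.le_ceil _))

namespace G53

/-- A discrete subgroup of `G_{5,3}` meets the center in a cyclic group. -/
theorem exists_center_generator (Γ : Subgroup G53) [DiscreteTopology Γ] :
    ∃ c : ℝ, ∀ t : ℝ, ⟨t, 0, 0, 0, 0⟩ ∈ Γ → ∃ z : ℤ, t = z * c := by
  let T : AddSubgroup ℝ :=
    { carrier := {t : ℝ | (⟨t, 0, 0, 0, 0⟩ : G53) ∈ Γ}
      zero_mem' := show (⟨0, 0, 0, 0, 0⟩ : G53) ∈ Γ from Γ.one_mem
      add_mem' := fun {a b} ha hb => by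
        have := Γ.mul_mem ha hb
        simpa [mul_def] using this
      neg_mem' := fun {a} ha => by
        have := Γ.inv_mem ha
        simpa [inv_def] using this }
  -- If dense, `T` would put nontrivial elements of `Γ` arbitrarily close to 1.
  rcases T.dense_or_cyclic with hT | ⟨c, hc⟩
  · exfalso
    obtain ⟨U, hU, hUΓ⟩ : ∃ U : Set G53, IsOpen U ∧ Subtype.val ⁻¹' U = ({1} : Set Γ) :=
      isOpen_induced_iff.1 (isOpen_discrete _)
    have cont : Continuous fun t : ℝ => (⟨t, 0, 0, 0, 0⟩ : G53) :=
      continuous_induced_rng.2 (by simp only [Function.comp_def, coords]; fun_prop)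
    have h1 : (1 : Γ) ∈ Subtype.val ⁻¹' U := by rw [hUΓ]; rfl
    obtain ⟨r, hr, hball⟩ := Metric.isOpen_iff.1 (hU.preimage cont) 0 h1
    obtain ⟨t, ht, htT⟩ := hT.exists_mem_open (isOpen_Ioo (a := 0) (b := r))
      (Set.nonempty_Ioo.2 hr)
    have : (⟨⟨t, 0, 0, 0, 0⟩, ht⟩ : Γ) ∈ Subtype.val ⁻¹' U :=
      hball (by rw [Metric.mem_ball, Real.dist_eq, sub_zero, abs_of_pos htT.1]; exact htT.2)
    rw [hUΓ, Set.mem_singleton_iff, Subtype.ext_iff] at this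
    exact htT.1.ne' (congrArg G53.h this)
  · rw [← AddSubgroup.zmultiples_eq_closure] at hc
    refine ⟨c, fun t ht => ?_⟩
    have : t ∈ T := ht
    rw [hc, AddSubgroup.mem_zmultiples_iff] at this
    obtain ⟨z, rfl⟩ := this
    exact ⟨z, by simp⟩

/-- The image of a cocompact subgroup of `G_{5,3}` in `ℝ³` is relatively dense. -/
theorem exists_forall_exists_mem_abs_sub_lt (Γ : Subgroup G53) [CompactSpace (G53 ⧸ Γ)] :
    ∃ C : ℝ, ∀ k m n : ℝ, ∃ x ∈ Γ, |x.k - k| < C ∧ |x.m - m| < C ∧ |x.n - n| < C := by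
  let B : ℕ → Set G53 := fun N => {x | |x.k| < N ∧ |x.m| < N ∧ |x.n| < N}
  have hB : ∀ N, IsOpen (B N) := fun N =>
    (isOpen_lt continuous_k.abs continuous_const).inter
      ((isOpen_lt continuous_m.abs continuous_const).inter
        (isOpen_lt continuous_n.abs continuous_const))
  have mono : Monotone B := fun M N hMN x ⟨h1, h2, h3⟩ => by
    have : (M : ℝ) ≤ N := by exact_mod_cast hMN
    exact ⟨h1.trans_le this, h2.trans_le this, h3.trans_le this⟩
  obtain ⟨N, hN⟩ := (isCompact_univ (X := G53 ⧸ Γ)).elim_directed_cover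
    (fun N => QuotientGroup.mk '' B N) (fun N => QuotientGroup.isOpenMap_coe _ (hB N))
    (fun q _ => by
      obtain ⟨x, rfl⟩ := QuotientGroup.mk_surjective q
      obtain ⟨N, hN⟩ := exists_nat_gt (max |x.k| (max |x.m| |x.n|))
      simp only [max_lt_iff] at hN
      exact Set.mem_iUnion.2 ⟨N, x, hN, rfl⟩)
    (Monotone.directed_le fun M N hMN => Set.image_mono (mono hMN))
  refine ⟨N, fun k m n => ?_⟩
  -- If g = (0,0,-k,-m,-n) and b lie in the same left coset, then g⁻¹b is in `Γ` and its last three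
  -- coordinates are those of b shifted by k, m, n.
  obtain ⟨b, ⟨h1, h2, h3⟩, hb⟩ := hN (Set.mem_univ (QuotientGroup.mk (⟨0, 0, -k, -m, -n⟩ : G53)))
  refine ⟨(⟨0, 0, -k, -m, -n⟩ : G53)⁻¹ * b, QuotientGroup.eq.1 hb.symm, ?_, ?_, ?_⟩ <;> simpa

theorem exists_mulEquiv_of_discrete_of_cocompact (Γ : Subgroup G53) [DiscreteTopology Γ]
    [CompactSpace (G53 ⧸ Γ)] :
    ∃ α β γ δ ε : ℤ, H53.Admissible α β γ δ ε ∧ Nonempty (Γ ≃* H53 α β γ δ ε) := by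
  obtain ⟨c, hc⟩ := exists_center_generator Γ
  obtain ⟨C, hC⟩ := exists_forall_exists_mem_abs_sub_lt Γ
  have hC0 : 0 < C := by
    obtain ⟨x, -, h, -⟩ := hC 0 0 0
    exact (abs_nonneg _).trans_lt h
  -- With 3C the large coordinates exceed 2C and the others stay below C, so the determinant giving
  -- the j-coordinate of [y,x] exceeds 4C² - C² > 0.
  obtain ⟨y, hy, -, y1, y2⟩ := hC 0 0 (3 * C)
  obtain ⟨x, hx, -, x1, x2⟩ := hC 0 (3 * C) 0
  rw [abs_lt] at y1 y2 x1 x2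
  have hyn : y.n ≠ 0 := by linarith
  have comm : ∀ x ∈ Γ, y * x * (x * y)⁻¹ ∈ Γ ⊓ subgroupJ := fun x hx =>
    ⟨Γ.mul_mem (Γ.mul_mem hy hx) (Γ.inv_mem (Γ.mul_mem hx hy)),
      by simp; ring, by simp; ring, by simp; ring⟩
  have comm_j : ∀ x, (y * x * (x * y)⁻¹).j = y.n * x.m - x.n * y.m := fun x => by
    simp [mul_def, inv_def]; ring
  have hj : ∃ x ∈ Γ ⊓ subgroupJ, x.j ≠ 0 := by
    refine ⟨_, comm x hx, ?_⟩
    rw [comm_j]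
    nlinarith
  have discrete_j : ∀ x ∈ Γ ⊓ subgroupJ, ∃ z : ℤ, x.j = z * (c / y.n) := by
    rintro x ⟨hx, h1, h2, h3⟩
    obtain ⟨z, hz⟩ := hc (y.n * x.j) (Subgroup.mem_of_mul_eq_mul_mul hy hx (by
      ext <;> simp [mul_def, h1, h2, h3] <;> ring))
    exact ⟨z, by field_simp; linarith⟩
  obtain ⟨d, discrete_n⟩ : ∃ d : ℝ, ∀ x ∈ Γ, ∃ z : ℤ, x.n = z * d := by
    obtain ⟨w, ⟨hw, h1, h2, h3⟩, h0⟩ := hj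
    refine ⟨c / w.j, fun x hx => ?_⟩
    obtain ⟨z, hz⟩ := hc (x.n * w.j) (Subgroup.mem_of_mul_eq_mul_mul hx hw (by
      ext <;> simp [mul_def, h1, h2, h3] <;> ring))
    exact ⟨z, by field_simp; linarith⟩
  refine exists_mulEquiv_H53 hc hj ?_ ?_ ⟨y, hy, hyn⟩
  -- Pigeonhole: n and the j-coordinate of the commutator with `y` are bounded and discrete, so two
  -- `g i` agree in both, hence in m and n. Spacing 2C with errors below C keeps their k-coordinates
  -- distinct.
  · choose g hg gk gm gn using fun i : ℕ => hC (2 * C * i) 0 0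
    simp only [sub_zero] at gm gn
    have mem : ∀ i, ((g i).n, y.n * (g i).m - (g i).n * y.m) ∈
        {x : ℝ | (∃ z : ℤ, x = z * d) ∧ |x| < C} ×ˢ
          {x : ℝ | (∃ z : ℤ, x = z * (c / y.n)) ∧ |x| < |y.n| * C + C * |y.m|} := fun i => by
      refine ⟨⟨discrete_n _ (hg i), gn i⟩, comm_j (g i) ▸ discrete_j _ (comm _ (hg i)), ?_⟩
      refine (abs_sub _ _).trans_lt ?_
      rw [abs_mul, abs_mul]
      have := mul_lt_mul_of_pos_left (gm i) (abs_pos.2 hyn)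
      have := mul_le_mul_of_nonneg_right (gn i).le (abs_nonneg y.m)
      linarith
    obtain ⟨a, b, hab, e⟩ := Set.Finite.exists_lt_map_eq_of_forall_mem mem
      ((Real.finite_setOf_intCast_mul_abs_lt _ _).prod (Real.finite_setOf_intCast_mul_abs_lt _ _))
    simp only [Prod.mk.injEq] at e
    obtain ⟨e1, e2⟩ := e
    rw [e1, sub_left_inj, mul_right_inj' hyn] at e2
    refine ⟨g b * (g a)⁻¹, ⟨Γ.mul_mem (hg b) (Γ.inv_mem (hg a)), by simp [e2], by simp [e1]⟩, ?_⟩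
    have h1 := abs_lt.1 (gk a)
    have h2 := abs_lt.1 (gk b)
    have h3 : (a : ℝ) + 1 ≤ b := by exact_mod_cast hab
    have : (g b).k + -(g a).k ≠ 0 := by nlinarith
    simpa using this
  · choose g hg _ gm gn using fun i : ℕ => hC 0 (2 * C * i) 0
    simp only [sub_zero] at gn
    have mem : ∀ i, (g i).n ∈ {x : ℝ | (∃ z : ℤ, x = z * d) ∧ |x| < C} := fun i =>
      ⟨discrete_n _ (hg i), gn i⟩
    obtain ⟨a, b, hab, e⟩ := Set.Finite.exists_lt_map_eq_of_forall_mem mem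
      (Real.finite_setOf_intCast_mul_abs_lt _ _)
    refine ⟨g b * (g a)⁻¹, ⟨Γ.mul_mem (hg b) (Γ.inv_mem (hg a)), ?_⟩, ?_⟩
    · simp [mem_subgroupM, e]
    have h1 := abs_lt.1 (gm a)
    have h2 := abs_lt.1 (gm b)
    have h3 : (a : ℝ) + 1 ≤ b := by exact_mod_cast hab
    have : (g b).m + -(g a).m ≠ 0 := by nlinarith
    simpa using this

/-- Nonzero powers of the standard generators lie in `K` and make every layer nontrivial; central
elements have integer coordinate, so c = 1 serves. -/
theorem exists_mulEquiv_of_finiteIndex (K : Subgroup H53Lattice) [K.FiniteIndex] :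
    ∃ α β γ δ ε : ℤ, H53.Admissible α β γ δ ε ∧ Nonempty (K ≃* H53 α β γ δ ε) := by
  have hpow : ∀ g ∈ H53Lattice, ∃ t : ℤ, t ≠ 0 ∧ g ^ t ∈ K.map H53Lattice.subtype := by
    intro g hg
    obtain ⟨t, ht, -, h⟩ := K.exists_pow_mem_of_index_ne_zero K.index_ne_zero_of_finite ⟨g, hg⟩
    exact ⟨t, by exact_mod_cast ht.ne', ⟨_, h, by simp⟩⟩
  obtain ⟨α, β, γ, δ, ε, h, ⟨φ⟩⟩ := exists_mulEquiv_H53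
    (Γ := K.map H53Lattice.subtype) (c := 1)
    (by
      rintro t ⟨⟨_, ⟨z, _, _, _, _, rfl⟩⟩, -, e⟩
      exact ⟨z, by simpa using (congrArg G53.h e).symm⟩)
    (by
      obtain ⟨t, ht, h⟩ := hpow ⟨0, 1, 0, 0, 0⟩ ⟨0, 1, 0, 0, 0, by simp⟩
      exact ⟨_, ⟨h, by simp [mem_subgroupJ]⟩, by simp [mk_zpow, ht]⟩)
    (by
      obtain ⟨t, ht, h⟩ := hpow ⟨0, 0, 1, 0, 0⟩ ⟨0, 0, 1, 0, 0, by simp⟩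
      exact ⟨_, ⟨h, by simp [mem_subgroupK]⟩, by simp [ht]⟩)
    (by
      obtain ⟨t, ht, h⟩ := hpow ⟨0, 0, 0, 1, 0⟩ ⟨0, 0, 0, 1, 0, by simp⟩
      exact ⟨_, ⟨h, by simp [mem_subgroupM]⟩, by simp [ht]⟩)
    (by
      obtain ⟨t, ht, h⟩ := hpow ⟨0, 0, 0, 0, 1⟩ ⟨0, 0, 0, 0, 1, by simp⟩
      exact ⟨_, h, by simp [ht]⟩)
  exact ⟨α, β, γ, δ, ε, h,
    ⟨(K.equivMapOfInjective _ H53Lattice.subtype_injective).trans φ⟩⟩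

end G53

/-! ### Realization inside the lattice -/

theorem Int.exists_add_mul_mem_Ico (a : ℤ) {p : ℤ} (hp : 0 < p) :
    ∃ z : ℤ, a + z * p ∈ Set.Ico 0 p :=
  ⟨-(a / p), by
    have h1 := Int.emod_add_mul_ediv a p
    have h2 := Int.emod_nonneg a hp.ne'
    have h3 := Int.emod_lt_of_pos a hp
    constructor <;> linarith⟩

namespace H53

variable {α β γ δ ε : ℤ}

/-- Right multiplication by powers of the given elements reduces n, m, k, j, h in this order without
disturbing those already reduced, so a finite box meets every left coset. -/
theorem finiteIndex_of_mem (S : Subgroup (H53 α β γ δ ε)) {h j j₁ j₂ k m n : ℤ} (h0 : 0 < h)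
    (j0 : 0 < j) (k0 : 0 < k) (m0 : 0 < m) (n0 : 0 < n) (hh : ⟨h, 0, 0, 0, 0⟩ ∈ S)
    (hj : ⟨0, j, 0, 0, 0⟩ ∈ S) (hk : ⟨0, j₁, k, 0, 0⟩ ∈ S) (hm : ⟨0, j₂, 0, m, 0⟩ ∈ S)
    (hn : ⟨0, 0, 0, 0, n⟩ ∈ S) : S.FiniteIndex := by
  let F : Finset (ℤ × ℤ × ℤ × ℤ × ℤ) := Finset.Ico 0 h ×ˢ Finset.Ico 0 j ×ˢ Finset.Ico 0 k ×ˢ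
    Finset.Ico 0 m ×ˢ Finset.Ico 0 n
  let f : F → H53 α β γ δ ε ⧸ S := fun q =>
    QuotientGroup.mk ⟨q.1.1, q.1.2.1, q.1.2.2.1, q.1.2.2.2.1, q.1.2.2.2.2⟩
  have hf : Function.Surjective f := by
    intro q
    obtain ⟨x, rfl⟩ := QuotientGroup.mk_surjective q
    suffices H : ∃ r ∈ S, (x * r).h ∈ Set.Ico 0 h ∧ (x * r).j ∈ Set.Ico 0 j ∧
        (x * r).k ∈ Set.Ico 0 k ∧ (x * r).m ∈ Set.Ico 0 m ∧ (x * r).n ∈ Set.Ico 0 n by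
      obtain ⟨r, hr, h1, h2, h3, h4, h5⟩ := H
      refine ⟨⟨((x * r).h, (x * r).j, (x * r).k, (x * r).m, (x * r).n), ?_⟩, ?_⟩
      · simp only [F, Finset.mem_product, Finset.mem_Ico]
        exact ⟨h1, h2, h3, h4, h5⟩
      · exact (QuotientGroup.mk_mul_of_mem x hr)
    obtain ⟨z₁, h₁⟩ := Int.exists_add_mul_mem_Ico x.n n0
    have r₁ := S.zpow_mem hn z₁
    rw [mk_zpow_n] at r₁
    set x₁ := x * ⟨0, 0, 0, 0, z₁ * n⟩ with e₁
    obtain ⟨z₂, h₂⟩ := Int.exists_add_mul_mem_Ico x₁.m m0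
    have r₂ := S.zpow_mem hm z₂
    rw [mk_zpow_m] at r₂
    set x₂ := x₁ * ⟨0, z₂ * j₂, 0, z₂ * m, 0⟩ with e₂
    obtain ⟨z₃, h₃⟩ := Int.exists_add_mul_mem_Ico x₂.k k0
    have r₃ := S.zpow_mem hk z₃
    rw [mk_zpow_k] at r₃
    set x₃ := x₂ * ⟨0, z₃ * j₁, z₃ * k, 0, 0⟩ with e₃
    obtain ⟨z₄, h₄⟩ := Int.exists_add_mul_mem_Ico x₃.j j0
    have r₄ := S.zpow_mem hj z₄
    rw [mk_zpow] at r₄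
    set x₄ := x₃ * ⟨z₄ * 0, z₄ * j, 0, 0, 0⟩ with e₄
    obtain ⟨z₅, h₅⟩ := Int.exists_add_mul_mem_Ico x₄.h h0
    have r₅ := S.zpow_mem hh z₅
    rw [mk_zpow] at r₅
    refine ⟨_, S.mul_mem (S.mul_mem (S.mul_mem (S.mul_mem r₁ r₂) r₃) r₄) r₅, ?_⟩
    rw [← mul_assoc, ← mul_assoc, ← mul_assoc, ← mul_assoc, ← e₁, ← e₂, ← e₃, ← e₄]
    have n₁ : x₁.n = x.n + z₁ * n := rfl
    have n₂ : x₂.n = x₁.n := by simp [e₂, mul_def]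
    have m₂ : x₂.m = x₁.m + z₂ * m := rfl
    have n₃ : x₃.n = x₂.n := by simp [e₃, mul_def]
    have m₃ : x₃.m = x₂.m := by simp [e₃, mul_def]
    have k₃ : x₃.k = x₂.k + z₃ * k := rfl
    have n₄ : x₄.n = x₃.n := by simp [e₄, mul_def]
    have m₄ : x₄.m = x₃.m := by simp [e₄, mul_def]
    have k₄ : x₄.k = x₃.k := by simp [e₄, mul_def]
    have j₄ : x₄.j = x₃.j + z₄ * j := by simp [e₄, mul_def]
    rw [← n₁, ← n₂, ← n₃, ← n₄] at h₁
    rw [← m₂, ← m₃, ← m₄] at h₂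
    rw [← k₃, ← k₄] at h₃
    rw [← j₄] at h₄
    simpa [mul_def] using ⟨h₅, h₄, h₃, h₂, h₁⟩
  have := Finite.of_surjective f hf
  exact Subgroup.finiteIndex_of_finite_quotient

/-- `H_{5,3}` is the group `H_{5,3}(1, 0, 1, 1, 0)`. -/
noncomputable def equivLattice : H53 1 0 1 1 0 ≃* H53Lattice :=
  MulEquiv.ofBijective
    (MonoidHom.mk' (fun x => ⟨⟨x.h, x.j, x.k, x.m, x.n⟩, x.h, x.j, x.k, x.m, x.n, rfl⟩) <| by
      intro x y
      have e : (2 : ℝ) * ((x.n * (x.n - 1) / 2 : ℤ) : ℝ) = (x.n : ℝ) * (x.n - 1) := by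
        exact_mod_cast int_two_mul_pred_half x.n
      ext <;> simp [mul_def, G53.mul_def]
      exact Or.inl (by linear_combination e / 2))
    ⟨fun x y hxy => by
      have hxy := congrArg Subtype.val hxy
      simp only [MonoidHom.mk'_apply, G53.mk.injEq, Int.cast_inj] at hxy
      obtain ⟨h1, h2, h3, h4, h5⟩ := hxy
      ext <;> assumption, by
      rintro ⟨_, h, j, k, m, n, rfl⟩
      exact ⟨⟨h, j, k, m, n⟩, rfl⟩⟩

theorem exists_finiteIndex_subgroup (hα : 0 < α) (hγ : 0 < γ) (hδ : 0 < δ) :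
    ∃ K : Subgroup H53Lattice, K.FiniteIndex ∧ Nonempty (H53 α β γ δ ε ≃* K) := by
  -- In [n,m], the part -αγ+1 of the j-entry of m cancels the triangular term αγ(αγ-1), leaving h^β
  -- j^α. The factors 2 avoid the half-integer (αγ-1)/2.
  have R : Relations α β γ δ ε (⟨2 * (α * γ), 0, 0, 0, 0⟩ : H53 1 0 1 1 0) ⟨0, 2 * γ, 0, 0, 0⟩
      ⟨0, 2 * ε, α * γ * δ, 0, 0⟩ ⟨0, 2 * β - α * γ + 1, 0, 2, 0⟩ ⟨0, 0, 0, 0, α * γ⟩ := by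
    constructor <;> (try rw [commute_iff_eq]) <;> ext <;> simp [mk_zpow, mul_def]
    any_goals ring1
    have := int_two_mul_pred_half (α * γ)
    linarith
  have αγ : 0 < α * γ := mul_pos hα hγ
  have inj : Function.Injective (lift R) := by
    refine injective_of_center hγ.ne' hδ.ne' _ fun x hx => ?_
    simpa [lift_apply, mk_zpow, mul_def, one_def, hα.ne', hγ.ne'] using congrArg H53.h hx
  have fin : (lift R).range.FiniteIndex := finiteIndex_of_mem _ (h := 2 * (α * γ)) (j := 2 * γ)
    (j₁ := 2 * ε) (j₂ := 2 * β - α * γ + 1) (k := α * γ * δ) (m := 2) (n := α * γ)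
    (by positivity) (by positivity) (mul_pos αγ hδ) two_pos αγ
    ⟨⟨1, 0, 0, 0, 0⟩, by simp [lift_apply]⟩
    ⟨⟨0, 1, 0, 0, 0⟩, by simp [lift_apply]⟩ ⟨⟨0, 0, 1, 0, 0⟩, by simp [lift_apply]⟩
    ⟨⟨0, 0, 0, 1, 0⟩, by simp [lift_apply]⟩ ⟨⟨0, 0, 0, 0, 1⟩, by simp [lift_apply]⟩
  refine ⟨(lift R).range.map (equivLattice : H53 1 0 1 1 0 →* H53Lattice), ?_,
    ⟨(MonoidHom.ofInjective inj).trans (equivLattice.subgroupMap _)⟩⟩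
  constructor
  rw [Subgroup.index_map_equiv]
  exact fin.index_ne_zero

end H53

/-! ### Invariance of the parameters -/

theorem Int.eq_of_dvd_mul_sub_mul {a b g u v : ℤ} (hg : 0 < g) (ha : 0 ≤ a) (ha' : 2 * a ≤ g)
    (hb : 0 ≤ b) (hb' : 2 * b ≤ g) (hu : u = 1 ∨ u = -1) (hv : v = 1 ∨ v = -1)
    (h : g ∣ a * u - b * v) : a = b := by
  have key : g ∣ a - b ∨ g ∣ a + b := by
    rcases hu with rfl | rfl <;> rcases hv with rfl | rfl
    · left; simpa using h
    · right; simpa using h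
    · right
      rw [← dvd_neg]
      simpa [sub_eq_add_neg, add_comm] using h
    · left
      rw [← dvd_neg]
      simpa [sub_eq_add_neg, add_comm] using h
  -- Since |a-b| < g, the first case gives a = b. In the second, 0 ≤ a+b ≤ g, and the extremes force
  -- a = b = 0 or a = b = g/2.
  rcases key with ⟨q, hq⟩ | ⟨q, hq⟩
  · have h1 : q < 1 := by by_contra! H; nlinarith
    have h2 : -1 < q := by by_contra! H; nlinarith
    obtain rfl : q = 0 := by omega
    linarith
  · have h1 : q < 2 := by by_contra! H; nlinarith
    have h2 : -1 < q := by by_contra! H; nlinarith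
    obtain rfl | rfl : q = 0 ∨ q = 1 := by omega
    all_goals linarith

theorem Int.eq_of_mul_mul_eq_mul {a b u v w : ℤ} (ha : 0 < a) (hb : 0 < b) (hu : u = 1 ∨ u = -1)
    (hv : v = 1 ∨ v = -1) (hw : w = 1 ∨ w = -1) (h : a * u * v = b * w) : a = b := by
  rcases hu with rfl | rfl <;> rcases hv with rfl | rfl <;> rcases hw with rfl | rfl <;> linarith

theorem Int.mul_eq_one_or_neg_one {u v : ℤ} (hu : u = 1 ∨ u = -1) (hv : v = 1 ∨ v = -1) :
    u * v = 1 ∨ u * v = -1 := by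
  rcases hu with rfl | rfl <;> rcases hv with rfl | rfl <;> simp

namespace H53

variable {α β γ δ ε : ℤ}

@[simp] theorem mul_k (x y : H53 α β γ δ ε) : (x * y).k = x.k + y.k := rfl
@[simp] theorem mul_m (x y : H53 α β γ δ ε) : (x * y).m = x.m + y.m := rfl
@[simp] theorem mul_n (x y : H53 α β γ δ ε) : (x * y).n = x.n + y.n := rfl

@[simp] theorem zpow_k (x : H53 α β γ δ ε) (t : ℤ) : (x ^ t).k = t * x.k := by
  induction t using Int.induction_on with
  | zero => simp [one_def]
  | succ i ih => rw [zpow_add_one, mul_k, ih]; ring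
  | pred i ih => rw [zpow_sub_one, mul_k, ih, inv_def]; ring

@[simp] theorem zpow_m (x : H53 α β γ δ ε) (t : ℤ) : (x ^ t).m = t * x.m := by
  induction t using Int.induction_on with
  | zero => simp [one_def]
  | succ i ih => rw [zpow_add_one, mul_m, ih]; ring
  | pred i ih => rw [zpow_sub_one, mul_m, ih, inv_def]; ring

@[simp] theorem zpow_n (x : H53 α β γ δ ε) (t : ℤ) : (x ^ t).n = t * x.n := by
  induction t using Int.induction_on with
  | zero => simp [one_def]
  | succ i ih => rw [zpow_add_one, mul_n, ih]; ring
  | pred i ih => rw [zpow_sub_one, mul_n, ih, inv_def]; ring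

theorem Admissible.two_mul_ε_le (h : Admissible α β γ δ ε) : 2 * ε ≤ Int.gcd γ δ := by
  have := h.ε_le
  rw [le_div_iff₀ two_pos, mul_comm] at this
  exact_mod_cast this

theorem Admissible.two_mul_β_le (h : Admissible α β γ δ ε) :
    2 * β ≤ Int.gcd α (Int.gcd γ (Int.gcd δ ε)) := by
  have := h.β_le
  rw [le_div_iff₀ two_pos, mul_comm] at this
  exact_mod_cast this

/-- Isomorphic admissible groups have equal parameters. -/
theorem Admissible.eq_of_mulEquiv {α' β' γ' δ' ε' : ℤ} (A : Admissible α β γ δ ε)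
    (A' : Admissible α' β' γ' δ' ε') (φ : H53 α β γ δ ε ≃* H53 α' β' γ' δ' ε') :
    (α, β, γ, δ, ε) = (α', β', γ', δ', ε') := by
  have R := relations.map (α := α) (β := β) (γ := γ) (δ := δ) (ε := ε) φ.toMonoidHom
  have hφ : ∀ x, φ x = lift R x := fun x => by
    conv_lhs => rw [eq_zpow_mul x]
    simp [lift_apply]
  have inj : ∀ t, lift R ⟨t, 0, 0, 0, 0⟩ = 1 → t = 0 := fun t ht => by
    rw [← hφ, map_eq_one_iff φ φ.injective] at ht
    exact congrArg H53.h ht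
  have surj : ∀ y, ∃ x, lift R x = y := fun y => (φ.surjective y).imp fun x hx => hφ x ▸ hx
  clear hφ
  generalize φ.toMonoidHom ⟨1, 0, 0, 0, 0⟩ = h at R inj surj
  generalize φ.toMonoidHom ⟨0, 1, 0, 0, 0⟩ = j at R inj surj
  generalize φ.toMonoidHom ⟨0, 0, 1, 0, 0⟩ = k at R inj surj
  generalize φ.toMonoidHom ⟨0, 0, 0, 1, 0⟩ = m at R inj surj
  generalize φ.toMonoidHom ⟨0, 0, 0, 0, 1⟩ = n at R inj surj
  simp only [lift_apply] at inj surj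
  have hα := A.α_pos
  have hγ := A.γ_pos
  have hδ := A.δ_pos
  have hα' := A'.α_pos
  have hγ' := A'.γ_pos
  have hδ' := A'.δ_pos
  -- The coordinates k, m, n are additive, so they vanish on commutators: first on h^γ, then on h^β
  -- j^α, hence on h and j.
  have hk : h.k = 0 := by
    have := congrArg H53.k R.mul_nj
    simp only [mul_k, zpow_k] at this
    exact (mul_eq_zero.1 (by linarith : γ * h.k = 0)).resolve_left hγ.ne'
  have hm : h.m = 0 := by
    have := congrArg H53.m R.mul_nj
    simp only [mul_m, zpow_m] at this
    exact (mul_eq_zero.1 (by linarith : γ * h.m = 0)).resolve_left hγ.ne'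
  have hn : h.n = 0 := by
    have := congrArg H53.n R.mul_nj
    simp only [mul_n, zpow_n] at this
    exact (mul_eq_zero.1 (by linarith : γ * h.n = 0)).resolve_left hγ.ne'
  have jk : j.k = 0 := by
    have := congrArg H53.k R.mul_nm
    simp only [mul_k, zpow_k, hk] at this
    exact (mul_eq_zero.1 (by linarith : α * j.k = 0)).resolve_left hα.ne'
  have jm : j.m = 0 := by
    have := congrArg H53.m R.mul_nm
    simp only [mul_m, zpow_m, hm] at this
    exact (mul_eq_zero.1 (by linarith : α * j.m = 0)).resolve_left hα.ne'
  have jn : j.n = 0 := by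
    have := congrArg H53.n R.mul_nm
    simp only [mul_n, zpow_n, hn] at this
    exact (mul_eq_zero.1 (by linarith : α * j.n = 0)).resolve_left hα.ne'
  -- Otherwise j would be central, contradicting [n,j] = h^γ ≠ 1.
  have jj : j.j ≠ 0 := by
    intro jj
    have e : n * j = j * n := by
      ext <;> simp [mul_def, jj, jk, jm, jn, add_comm]
    have := R.mul_nj
    rw [e, mul_assoc, right_eq_mul] at this
    exact hγ.ne' (inj γ (by simpa using this))
  have mn : m.n = 0 := by
    have := congrArg H53.h R.comm_jm.eq
    simp only [mul_def, jk, jm, jn, zero_mul, mul_zero, Int.zero_ediv] at this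
    have : γ' * m.n * j.j = 0 := by linarith
    simpa [hγ'.ne', jj] using this
  have kn : k.n = 0 := by
    have := congrArg H53.h R.comm_jk.eq
    simp only [mul_def, jk, jm, jn, zero_mul, mul_zero, Int.zero_ediv] at this
    have : γ' * k.n * j.j = 0 := by linarith
    simpa [hγ'.ne', jj] using this
  have nn : n.n = 1 ∨ n.n = -1 := by
    obtain ⟨x, hx⟩ := surj ⟨0, 0, 0, 0, 1⟩
    have := congrArg H53.n hx
    simp only [mul_n, zpow_n, hn, jn, kn, mn, mul_zero, zero_add] at this
    exact Int.eq_one_or_neg_one_of_mul_eq_one (by rwa [mul_comm] at this)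
  have nn0 : n.n ≠ 0 := by rcases nn with h | h <;> rw [h] <;> norm_num
  have hj : h.j = 0 := by
    have := congrArg H53.h R.comm_hn.eq
    simp only [mul_def, hk, hm, hn, zero_mul, mul_zero, Int.zero_ediv] at this
    have : γ' * n.n * h.j = 0 := by linarith
    simpa [hγ'.ne', nn0] using this
  obtain ⟨h₁, rfl⟩ : ∃ t, h = ⟨t, 0, 0, 0, 0⟩ := ⟨h.h, by ext <;> simp [*]⟩
  obtain ⟨h₂, j₂, rfl⟩ : ∃ s t, j = ⟨s, t, 0, 0, 0⟩ := ⟨j.h, j.j, by ext <;> simp [*]⟩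
  have km : k.m = 0 := by
    have := congrArg H53.j R.mul_nk
    rw [mk_zpow] at this
    simp only [mul_def, kn, zero_mul, mul_zero, Int.zero_ediv] at this
    have : α' * n.n * k.m = 0 := by linarith
    simpa [hα'.ne', nn0] using this
  obtain ⟨h₃, j₃, k₃, rfl⟩ : ∃ s t u, k = ⟨s, t, u, 0, 0⟩ :=
    ⟨k.h, k.j, k.k, by ext <;> simp [*]⟩
  obtain ⟨h₄, j₄, k₄, m₄, rfl⟩ : ∃ s t u v, m = ⟨s, t, u, v, 0⟩ :=
    ⟨m.h, m.j, m.k, m.m, by ext <;> simp [*]⟩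
  -- The images are now triangular apart from the entries of n, so surjectivity makes each remaining
  -- diagonal entry a unit.
  have unit : ∀ {u v : ℤ}, u * v = 1 → v = 1 ∨ v = -1 := fun {u v} e =>
    Int.eq_one_or_neg_one_of_mul_eq_one (by rwa [mul_comm] at e)
  have um : m₄ = 1 ∨ m₄ = -1 := by
    obtain ⟨x, hx⟩ := surj ⟨0, 0, 0, 1, 0⟩
    have xn : x.n = 0 := by simpa [nn0] using congrArg H53.n hx
    exact unit (by simpa [xn] using congrArg H53.m hx)
  have um0 : m₄ ≠ 0 := by rcases um with rfl | rfl <;> norm_num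
  have uk : k₃ = 1 ∨ k₃ = -1 := by
    obtain ⟨x, hx⟩ := surj ⟨0, 0, 1, 0, 0⟩
    have xn : x.n = 0 := by simpa [nn0] using congrArg H53.n hx
    have xm : x.m = 0 := by simpa [xn, um0] using congrArg H53.m hx
    exact unit (by simpa [xn, xm] using congrArg H53.k hx)
  have uk0 : k₃ ≠ 0 := by rcases uk with rfl | rfl <;> norm_num
  have uj : j₂ = 1 ∨ j₂ = -1 := by
    obtain ⟨x, hx⟩ := surj ⟨0, 1, 0, 0, 0⟩
    have xn : x.n = 0 := by simpa [nn0] using congrArg H53.n hx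
    have xm : x.m = 0 := by simpa [xn, um0] using congrArg H53.m hx
    have xk : x.k = 0 := by simpa [xn, xm, uk0] using congrArg H53.k hx
    simp only [xn, xm, xk, zpow_zero, mul_one, mk_zpow] at hx
    exact unit (by simpa [mul_def] using congrArg H53.j hx)
  have uh : h₁ = 1 ∨ h₁ = -1 := by
    obtain ⟨x, hx⟩ := surj ⟨1, 0, 0, 0, 0⟩
    have xn : x.n = 0 := by simpa [nn0] using congrArg H53.n hx
    have xm : x.m = 0 := by simpa [xn, um0] using congrArg H53.m hx
    have xk : x.k = 0 := by simpa [xn, xm, uk0] using congrArg H53.k hx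
    simp only [xn, xm, xk, zpow_zero, mul_one, mk_zpow] at hx
    have xj : x.j = 0 := by simpa [mul_def, show j₂ ≠ 0 from jj] using congrArg H53.j hx
    exact unit (by simpa [mul_def, xj] using congrArg H53.h hx)
  have E₁ := congrArg H53.h R.mul_nj
  have E₂ := congrArg H53.h R.mul_mk
  have E₃ := congrArg H53.h R.mul_nk
  have E₄ := congrArg H53.j R.mul_nm
  have E₅ := congrArg H53.h R.mul_nm
  simp only [mk_zpow, mul_def, zero_mul, mul_zero, zero_add, add_zero, Int.zero_ediv]
    at E₁ E₂ E₃ E₄ E₅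
  obtain rfl : α' = α := Int.eq_of_mul_mul_eq_mul hα' hα nn um uj (by linarith)
  obtain rfl : γ' = γ := Int.eq_of_mul_mul_eq_mul hγ' hγ nn uj uh (by linarith)
  obtain rfl : δ' = δ := Int.eq_of_mul_mul_eq_mul hδ' hδ um uk uh (by linarith)
  have hg : 0 < (Int.gcd γ' δ' : ℤ) := by
    exact_mod_cast Int.gcd_pos_of_ne_zero_left _ hγ.ne'
  obtain rfl : ε = ε' := by
    refine Int.eq_of_dvd_mul_sub_mul hg A.ε_nonneg A.two_mul_ε_le A'.ε_nonneg A'.two_mul_ε_le uh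
      (Int.mul_eq_one_or_neg_one nn uk) ?_
    have : ε * h₁ - ε' * (n.n * k₃) = γ' * (n.n * j₃) + δ' * (n.m * k₃) := by linarith
    rw [this]
    exact dvd_add (Dvd.dvd.mul_right (Int.gcd_dvd_left _ _) _)
      (Dvd.dvd.mul_right (Int.gcd_dvd_right _ _) _)
  have hg' : 0 < (Int.gcd α' (Int.gcd γ' (Int.gcd δ' ε)) : ℤ) := by
    exact_mod_cast Int.gcd_pos_of_ne_zero_left _ hα.ne'
  obtain rfl : β = β' := by
    refine Int.eq_of_dvd_mul_sub_mul hg' A.β_nonneg A.two_mul_β_le A'.β_nonneg A'.two_mul_β_le uh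
      (Int.mul_eq_one_or_neg_one nn um) ?_
    -- The h-coordinate of the relation for [n,m] shows that β changes only by a sign and a
    -- combination of α, γ, δ, ε.
    have : β * h₁ - β' * (n.n * m₄) = α' * (γ' * m₄ * (n.n * (n.n - 1) / 2) - h₂) +
        γ' * (n.n * j₄) + δ' * (n.m * k₄ - m₄ * n.k) + ε * (n.n * k₄) := by linarith
    rw [this]
    have d₁ := Int.gcd_dvd_left α' (Int.gcd γ' (Int.gcd δ' ε))
    have d₂ := Int.gcd_dvd_right α' (Int.gcd γ' (Int.gcd δ' ε))
    have d₃ := d₂.trans (Int.gcd_dvd_left γ' (Int.gcd δ' ε))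
    have d₄ := d₂.trans (Int.gcd_dvd_right γ' (Int.gcd δ' ε))
    have d₅ := d₄.trans (Int.gcd_dvd_left δ' ε)
    have d₆ := d₄.trans (Int.gcd_dvd_right δ' ε)
    exact dvd_add (dvd_add (dvd_add (d₁.mul_right _) (d₃.mul_right _)) (d₅.mul_right _))
      (d₆.mul_right _)
  rfl

end H53

theorem theorem1 :
    (∀ H : Subgroup G53, DiscreteTopology H → CompactSpace (G53 ⧸ H) →
      ∃ α β γ δ ε : ℤ, H53.Admissible α β γ δ ε ∧ Nonempty (H ≃* H53 α β γ δ ε)) ∧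
    (∀ α β γ δ ε α' β' γ' δ' ε' : ℤ,
      H53.Admissible α β γ δ ε → H53.Admissible α' β' γ' δ' ε' →
      (α, β, γ, δ, ε) ≠ (α', β', γ', δ', ε') →
      IsEmpty (H53 α β γ δ ε ≃* H53 α' β' γ' δ' ε')) ∧
    (∀ α β γ δ ε : ℤ, H53.Admissible α β γ δ ε →
      ∃ K : Subgroup H53Lattice, K.FiniteIndex ∧ Nonempty (H53 α β γ δ ε ≃* K)) ∧
    (∀ K : Subgroup H53Lattice, K.FiniteIndex →
      ∃ α β γ δ ε : ℤ, H53.Admissible α β γ δ ε ∧ Nonempty (K ≃* H53 α β γ δ ε)) := by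
  refine ⟨fun H _ _ => G53.exists_mulEquiv_of_discrete_of_cocompact H, ?_, ?_,
    fun K _ => G53.exists_mulEquiv_of_finiteIndex K⟩
  · intro α β γ δ ε α' β' γ' δ' ε' A A' hne
    exact ⟨fun φ => hne (A.eq_of_mulEquiv A' φ)⟩
  · intro α β γ δ ε A
    exact H53.exists_finiteIndex_subgroup A.α_pos A.γ_pos A.δ_pos
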